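/- Let $\mathcal C$ be a dagger bicategory: every 2-morphism $\alpha:f\Rightarrow g$ has a converse $\alpha^\dagger:g\Rightarrow f$, the converse is involutive, contravariant for vertical and covariant for horizontal composition, and the structural 2-isomorphisms are unitary (a 2-morphism is unitary if its converse is its two-sided inverse). Let $\mathcal C$ carry a tensor product pseudofunctor $\boxtimes:\mathcal C\times\mathcal C\to\mathcal C$ compatible with $\dagger$ and a unit object $\mathbf 1$ with left and right unitors $\mathbf 1\boxtimes X\simeq X\simeq X\boxtimes\mathbf 1$ that are pseudonatural adjoint equivalences and are isomorphic at $X=\mathbf 1$, all structural 2-isomorphisms being unitary (for example, a symmetric monoidal dagger bicategory). Composition of 1-morphisms is written from left to right. Let $A$ and $B$ be objects with boundaries $l_A:\mathbf 1\to A$, $r_A:A\to\mathbf 1$ and $l_B:\mathbf 1\to B$, $r_B:B\to\mathbf 1$ satisfying the topological axioms: for $G\in\{A,B\}$ there are creation $\epsilon_G^\dagger:\mathrm{id}_{\mathbf 1}\Rightarrow l_G r_G$ and gluing $\mu_G:r_G l_G\Rightarrow\mathrm{id}_G$ which are unit and counit of an adjunction $l_G\dashv r_G$; their converses $\epsilon_G$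 (destruction) and $\mu_G^\dagger$ (separation) then exhibit $r_G\dashv l_G$. Let $\delta:l_A r_A\Rightarrow l_B r_B$ be a complementary structure: $\delta$ is unitary and so is its partial transpose $\delta':r_A l_B\Rightarrow r_A l_B$, the composite $$r_A l_B\xRightarrow{\ \mu_A^\dagger\ } r_A l_A r_A l_B\xRightarrow{\ \delta\ } r_A l_B r_B l_B\xRightarrow{\ \mu_B\ } r_A l_B .$$ Assume, as is implicit in drawing $\delta$ as a vertex that may be rotated in the plane, that the clockwise and the anticlockwise half turn of $\delta$ (its two transposes $l_B r_B\Rightarrow l_A r_A$, formed with the cups and caps above) coincide. Let $D=A\boxtimes B$, with boundaries $$l_D:\mathbf 1\xrightarrow{l_B}B\simeq\mathbf 1\boxtimes B\xrightarrow{l_A\boxtimes B}A\boxtimes B,\qquad r_D:A\boxtimes B\xrightarrow{A\boxtimes r_B}A\boxtimes\mathbf 1\simeq A\xrightarrow{r_A}\mathbf 1,$$ and with the adjunction $l_D\dashv r_D$ composed from those of $A$ and $B$, after crossing the two right boundaries by the interchange isomorphism of $\boxtimes$. Let $\chi$ be the interchange isomorphism from $r_B l_A$ to the composite $B\simeq\mathbf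 1\boxtimes B\xrightarrow{l_A\boxtimes B}A\boxtimes B\xrightarrow{A\boxtimes r_B}A\boxtimes\mathbf 1\simeq A$. Define $\lambda:(l_A r_A)(l_B r_B)\Rightarrow l_D r_D$ as the composite $$l_A(r_A l_B)r_B\xRightarrow{\ l_A\,\delta'\,r_B\ } (l_A r_A)(l_B r_B)\xRightarrow{\ \delta\,\cdot\,\delta^\dagger\ }(l_B r_B)(l_A r_A)=l_B(r_B l_A)r_A\xRightarrow{\ l_B\,\chi\,r_A\ } l_D r_D .$$ Then $\lambda$ is a communication structure: $\lambda$ is unitary, and so is its partial transpose $\lambda':(l_B r_B)l_D\Rightarrow(l_A r_A)l_D$, obtained by bending the strip $l_A r_A$ up on the left (with $\epsilon_A^\dagger$ and $\mu_A^\dagger$) and the boundary $r_D$ down on the right (with the counit $r_D l_D\Rightarrow\mathrm{id}_D$). -/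

import Mathlib

open CategoryTheory Bicategory

universe w v u

/-! ### Daggers on 2-morphisms -/

/-- A dagger bicategory: every 2-morphism `α : f ⟶ g` has a converse `dag α : g ⟶ f`. The converse
is an involution, reverses vertical composition, preserves horizontal composition, and the
coherence 2-isomorphisms of the bicategory are unitary. -/
class DaggerBicategory (C : Type u) [Bicategory.{w, v} C] where
  /-- The converse of a 2-morphism. -/
  dag {a b : C} {f g : a ⟶ b} (α : f ⟶ g) : g ⟶ f
  dag_dag {a b : C} {f g : a ⟶ b} (α : f ⟶ g) : dag (dag α) = α
  dag_id {a b : C} (f : a ⟶ b) : dag (𝟙 f) = 𝟙 f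
  dag_comp {a b : C} {f g h : a ⟶ b} (α : f ⟶ g) (β : g ⟶ h) :
    dag (α ≫ β) = dag β ≫ dag α
  dag_whiskerLeft {a b c : C} (f : a ⟶ b) {g h : b ⟶ c} (α : g ⟶ h) :
    dag (f ◁ α) = f ◁ dag α
  dag_whiskerRight {a b c : C} {f g : a ⟶ b} (α : f ⟶ g) (h : b ⟶ c) :
    dag (α ▷ h) = dag α ▷ h
  dag_associator {a b c d : C} (f : a ⟶ b) (g : b ⟶ c) (h : c ⟶ d) :
    dag (α_ f g h).hom = (α_ f g h).inv
  dag_leftUnitor {a b : C} (f : a ⟶ b) : dag (λ_ f).hom = (λ_ f).inv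
  dag_rightUnitor {a b : C} (f : a ⟶ b) : dag (ρ_ f).hom = (ρ_ f).inv

open DaggerBicategory

section Dagger

variable {C : Type u} [Bicategory.{w, v} C] [DaggerBicategory C]

/-- A 2-morphism is unitary if its converse is its two-sided inverse. -/
def IsUnitary {a b : C} {f g : a ⟶ b} (α : f ⟶ g) : Prop :=
  α ≫ dag α = 𝟙 f ∧ dag α ≫ α = 𝟙 g

theorem dag_associator_inv {a b c d : C} (f : a ⟶ b) (g : b ⟶ c) (h : c ⟶ d) :
    dag (α_ f g h).inv = (α_ f g h).hom := by
  rw [← dag_associator, dag_dag]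

theorem dag_leftUnitor_inv {a b : C} (f : a ⟶ b) : dag (λ_ f).inv = (λ_ f).hom := by
  rw [← dag_leftUnitor, dag_dag]

theorem dag_rightUnitor_inv {a b : C} (f : a ⟶ b) : dag (ρ_ f).inv = (ρ_ f).hom := by
  rw [← dag_rightUnitor, dag_dag]

/-- In a dagger bicategory adjunctions are ambidextrous: the converses of the counit and of the
unit of `f ⊣ g` are the unit and the counit of `g ⊣ f`. -/
def daggerAdjunction {a b : C} {f : a ⟶ b} {g : b ⟶ a} (adj : f ⊣ g) : g ⊣ f where
  unit := dag adj.counit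
  counit := dag adj.unit
  left_triangle := by
    have h := congrArg dag adj.right_triangle
    simpa [leftZigzag, rightZigzag, bicategoricalComp, dag_comp, dag_whiskerLeft,
      dag_whiskerRight, dag_associator, dag_associator_inv, dag_leftUnitor, dag_leftUnitor_inv,
      dag_rightUnitor, dag_rightUnitor_inv, dag_id] using h
  right_triangle := by
    have h := congrArg dag adj.left_triangle
    simpa [leftZigzag, rightZigzag, bicategoricalComp, dag_comp, dag_whiskerLeft,
      dag_whiskerRight, dag_associator, dag_associator_inv, dag_leftUnitor, dag_leftUnitor_inv,
      dag_rightUnitor, dag_rightUnitor_inv, dag_id] using h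

end Dagger

/-- Transport of an adjunction along an isomorphism of right adjoints. -/
def adjunctionOfRightIso {C : Type u} [Bicategory.{w, v} C] {a b : C} {f : a ⟶ b} {g g' : b ⟶ a}
    (adj : f ⊣ g) (e : g ≅ g') : f ⊣ g' where
  unit := adj.unit ≫ f ◁ e.hom
  counit := e.inv ▷ f ≫ adj.counit
  left_triangle := by
    rw [← adj.left_triangle]
    simp [leftZigzag, bicategoricalComp]
  right_triangle := by
    have h : g' ◁ (adj.unit ≫ f ◁ e.hom) ⊗≫ (e.inv ▷ f ≫ adj.counit) ▷ g' =
        e.inv ▷ 𝟙 a ≫ rightZigzag adj.unit adj.counit ≫ 𝟙 b ◁ e.hom := by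
      calc
        _ = 𝟙 _ ⊗≫ g' ◁ adj.unit ⊗≫ ((g' ≫ f) ◁ e.hom ≫ (e.inv ▷ f) ▷ g') ⊗≫
              adj.counit ▷ g' ⊗≫ 𝟙 _ := by bicategory
        _ = 𝟙 _ ⊗≫ (g' ◁ adj.unit ≫ e.inv ▷ (f ≫ g)) ⊗≫
              ((g ≫ f) ◁ e.hom ≫ adj.counit ▷ g') ⊗≫ 𝟙 _ := by
          rw [whisker_exchange (e.inv ▷ f) e.hom]; bicategory
        _ = _ := by
          rw [whisker_exchange e.inv adj.unit, whisker_exchange adj.counit e.hom]; bicategory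
    rw [rightZigzag, h, adj.right_triangle]
    simp

/-! ### The tensor product -/

/-- A dagger bicategory with a tensor product and a unit object: the part of the structure of a
(symmetric) monoidal dagger bicategory that does not involve the associator or the braiding.
All structural 2-isomorphisms are unitary. -/
class TensorBicategory (C : Type u) [Bicategory.{w, v} C] [DaggerBicategory C] where
  /-- The tensor product (layering of regions). -/
  tensor : (C × C) ⥤ᵖ C
  dag_map₂ {X Y : C × C} {f g : X ⟶ Y} (α : f ⟶ g) :
    dag (tensor.map₂ α) = tensor.map₂ (a := X) (b := Y) (f := g) (g := f) (dag α.1, dag α.2)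
  mapId_unitary (X : C × C) : IsUnitary (tensor.mapId X).hom
  mapComp_unitary {X Y Z : C × C} (f : X ⟶ Y) (g : Y ⟶ Z) : IsUnitary (tensor.mapComp f g).hom
  /-- The unit object (the unshaded region). -/
  unit : C
  /-- The left unitor `unit ⊠ X ⟶ X`, pseudonatural in `X`. -/
  leftUnitor : Pseudofunctor.StrongTrans
    ((Prod.sectR unit C).toPseudofunctor.comp tensor) (Pseudofunctor.id C)
  leftUnitor_naturality_unitary {X Y : C} (f : X ⟶ Y) : IsUnitary (leftUnitor.naturality f).hom
  /-- The inverse of the left unitor. -/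
  leftUnitorInv (X : C) : X ⟶ tensor.obj (unit, X)
  /-- The left unitor is an adjoint equivalence. -/
  leftUnitorAdj (X : C) : leftUnitorInv X ⊣ leftUnitor.app X
  leftUnitorAdj_unit_unitary (X : C) : IsUnitary (leftUnitorAdj X).unit
  leftUnitorAdj_counit_unitary (X : C) : IsUnitary (leftUnitorAdj X).counit
  /-- The right unitor `X ⊠ unit ⟶ X`, pseudonatural in `X`. -/
  rightUnitor : Pseudofunctor.StrongTrans
    ((Prod.sectL C unit).toPseudofunctor.comp tensor) (Pseudofunctor.id C)
  rightUnitor_naturality_unitary {X Y : C} (f : X ⟶ Y) : IsUnitary (rightUnitor.naturality f).hom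
  /-- The inverse of the right unitor. -/
  rightUnitorInv (X : C) : X ⟶ tensor.obj (X, unit)
  /-- The right unitor is an adjoint equivalence. -/
  rightUnitorAdj (X : C) : rightUnitorInv X ⊣ rightUnitor.app X
  rightUnitorAdj_unit_unitary (X : C) : IsUnitary (rightUnitorAdj X).unit
  rightUnitorAdj_counit_unitary (X : C) : IsUnitary (rightUnitorAdj X).counit
  /-- The two unitors agree on the unit object, up to a unitary 2-morphism. -/
  unitorIso : leftUnitor.app unit ≅ rightUnitor.app unit
  unitorIso_unitary : IsUnitary unitorIso.hom


open TensorBicategory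

section Tensor

variable {C : Type u} [Bicategory.{w, v} C] [DaggerBicategory C] [TensorBicategory C]

/-- Layering with the region `X` in the first layer, as a pseudofunctor. -/
abbrev leftSheet (X : C) : C ⥤ᵖ C := (Prod.sectR X C).toPseudofunctor.comp tensor

/-- Layering with the region `Y` in the second layer, as a pseudofunctor. -/
abbrev rightSheet (Y : C) : C ⥤ᵖ C := (Prod.sectL C Y).toPseudofunctor.comp tensor

/-- The overlap of two regions. -/
abbrev overlay (X Y : C) : C := tensor.obj (X, Y)

/-- The wire `g` in the second layer, with the region `X` in the first layer. -/
def secondLayer (X : C) {Y Y' : C} (g : Y ⟶ Y') : overlay X Y ⟶ overlay X Y' :=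
  (leftSheet X).map g

/-- The wire `f` in the first layer, with the region `Y` in the second layer. -/
def firstLayer {X X' : C} (f : X ⟶ X') (Y : C) : overlay X Y ⟶ overlay X' Y :=
  (rightSheet Y).map f

/-- An adjunction in the first layer. -/
def firstLayerAdj {X X' : C} {f : X ⟶ X'} {g : X' ⟶ X} (adj : f ⊣ g) (Y : C) :
    firstLayer f Y ⊣ firstLayer g Y :=
  (rightSheet Y).mapAdjunction adj

/-- Wires in different layers can be interchanged:
`(f ⊠ Y) ≫ (X' ⊠ g) ≅ f ⊠ g ≅ (X ⊠ g) ≫ (f ⊠ Y')`. -/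
def interchange {X X' Y Y' : C} (f : X ⟶ X') (g : Y ⟶ Y') :
    firstLayer f Y ≫ secondLayer X' g ≅ secondLayer X g ≫ firstLayer f Y' :=
  (tensor.mapComp (a := (X, Y)) (b := (X', Y)) (c := (X', Y')) (f, 𝟙 Y) (𝟙 X', g)).symm ≪≫
    tensor.map₂Iso (Iso.prod (ρ_ f ≪≫ (λ_ f).symm) (λ_ g ≪≫ (ρ_ g).symm)) ≪≫
    tensor.mapComp (a := (X, Y)) (b := (X, Y')) (c := (X', Y')) (𝟙 X, g) (f, 𝟙 Y')

/-- The left unitor at `X`. -/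
def leftUnit (X : C) : overlay unit X ⟶ X := leftUnitor.app X

/-- The right unitor at `X`. -/
def rightUnit (X : C) : overlay X unit ⟶ X := rightUnitor.app X

/-- The inverse of the left unitor at `X`. -/
def leftUnitInv (X : C) : X ⟶ overlay unit X := leftUnitorInv X

/-- The adjoint equivalence given by the left unitor at `X`. -/
def leftUnitAdj (X : C) : leftUnitInv X ⊣ leftUnit X := leftUnitorAdj X

/-- Naturality of the left unitor. -/
def leftUnitNat {X Y : C} (f : X ⟶ Y) :
    secondLayer unit f ≫ leftUnit Y ≅ leftUnit X ≫ f := leftUnitor.naturality f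

/-- Naturality of the right unitor. -/
def rightUnitNat {X Y : C} (f : X ⟶ Y) :
    firstLayer f unit ≫ rightUnit Y ≅ rightUnit X ≫ f := rightUnitor.naturality f

/-- The two unitors agree on the unit object. -/
def unitIso : leftUnit (unit : C) ≅ rightUnit (unit : C) := unitorIso

/-! ### Boundaries -/

/-- Left and right boundaries of a region `G`. The unit of the adjunction is creation
`𝟙 ⟶ left ≫ right` and its counit is gluing `right ≫ left ⟶ 𝟙`; their converses are destruction
and separation. The two triangle identities, with their converses (`daggerAdjunction`), are the
four topological (ambidextrous adjunction) axioms. One-morphisms are composed from left to right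
across the diagram. -/
structure Boundary (G : C) where
  /-- The left boundary: unshaded to the left, `G` to the right. -/
  left : (unit : C) ⟶ G
  /-- The right boundary: `G` to the left, unshaded to the right. -/
  right : G ⟶ (unit : C)
  /-- Creation and gluing. -/
  adj : left ⊣ right

namespace Boundary

variable {G : C} (b : Boundary G)

/-- The whole system: a strip of `G` between its two boundaries. -/
abbrev strip : (unit : C) ⟶ unit := b.left ≫ b.right

/-- Creation. -/
abbrev create : 𝟙 (unit : C) ⟶ b.left ≫ b.right := b.adj.unit

/-- Gluing. -/
abbrev glue : b.right ≫ b.left ⟶ 𝟙 G := b.adj.counit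

/-- Destruction. -/
abbrev destroy : b.left ≫ b.right ⟶ 𝟙 (unit : C) := dag b.adj.unit

/-- Separation. -/
abbrev separate : 𝟙 G ⟶ b.right ≫ b.left := dag b.adj.counit

/-- The cup on a strip: create a strip, then separate it into two. -/
def cup : 𝟙 (unit : C) ⟶ b.strip ≫ b.strip :=
  b.create ⊗≫ b.left ◁ b.separate ▷ b.right ⊗≫ 𝟙 _

/-- The cap on a strip: glue two strips, then destroy the result. -/
def cap : b.strip ≫ b.strip ⟶ 𝟙 (unit : C) :=
  𝟙 _ ⊗≫ b.left ◁ b.glue ▷ b.right ⊗≫ b.destroy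

end Boundary

/-! ### Complementary structures -/

section Complementary

variable {A B : C} (a : Boundary A) (b : Boundary B)

/-- The partial transpose of `δ` (a clockwise quarter turn): the left boundary of `A` is bent up
on the left, the right boundary of `B` is bent down on the right. -/
def partialTranspose (δ : a.strip ⟶ b.strip) : a.right ≫ b.left ⟶ a.right ≫ b.left :=
  𝟙 _ ⊗≫ a.separate ▷ (a.right ≫ b.left) ⊗≫ a.right ◁ δ ▷ b.left ⊗≫
    (a.right ≫ b.left) ◁ b.glue ⊗≫ 𝟙 _

/-- A complementary structure. -/
def IsComplementaryStructure (δ : a.strip ⟶ b.strip) : Prop :=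
  IsUnitary δ ∧ IsUnitary (partialTranspose a b δ)

/-- Clockwise half turn of `δ`. -/
def halfTurnClockwise (δ : a.strip ⟶ b.strip) : b.strip ⟶ a.strip :=
  𝟙 _ ⊗≫ a.cup ▷ b.strip ⊗≫ a.strip ◁ δ ▷ b.strip ⊗≫ a.strip ◁ b.cap ⊗≫ 𝟙 _

/-- Anticlockwise half turn of `δ`. -/
def halfTurnAnticlockwise (δ : a.strip ⟶ b.strip) : b.strip ⟶ a.strip :=
  𝟙 _ ⊗≫ b.strip ◁ a.cup ⊗≫ b.strip ◁ δ ▷ a.strip ⊗≫ b.cap ▷ a.strip ⊗≫ 𝟙 _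

/-- The vertex `δ` may be rotated in the plane: only its angle matters, that is, the two half
turns of `δ` agree (equivalently, a full turn does not change `δ`). -/
def IsRotatable (δ : a.strip ⟶ b.strip) : Prop :=
  halfTurnClockwise a b δ = halfTurnAnticlockwise a b δ

end Complementary

/-! ### Communication structures -/

section Communication

variable {A B D : C} (a : Boundary A) (b : Boundary B) (d : Boundary D)

/-- The partial transpose of `l` (a clockwise quarter turn): the strip of `A` is bent up on the
left, the right boundary of `D` is bent down on the right. -/
def commPartialTranspose (l : a.strip ≫ b.strip ⟶ d.strip) :
    b.strip ≫ d.left ⟶ a.strip ≫ d.left :=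
  𝟙 _ ⊗≫ a.cup ▷ (b.strip ≫ d.left) ⊗≫ a.strip ◁ l ▷ d.left ⊗≫
    (a.strip ≫ d.left) ◁ d.glue ⊗≫ 𝟙 _

/-- A communication structure. -/
def IsCommunicationStructure (l : a.strip ≫ b.strip ⟶ d.strip) : Prop :=
  IsUnitary l ∧ IsUnitary (commPartialTranspose a b d l)

end Communication

/-! ### Overlapping regions -/

section Overlap

variable {A B : C} (a : Boundary A) (b : Boundary B)

/-- The left boundary of the overlap `A ⊠ B`: first the left boundary of `B`, then that of `A` in
its own layer. -/
def overlapLeft : (unit : C) ⟶ overlay A B :=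
  b.left ≫ leftUnitInv B ≫ firstLayer a.left B

/-- The right boundary of the overlap `A ⊠ B`: first the right boundary of `B` in its own layer,
then that of `A`. -/
def overlapRight : overlay A B ⟶ (unit : C) :=
  secondLayer A b.right ≫ rightUnit A ≫ a.right

/-- The two right boundaries cross. -/
def crossRight :
    firstLayer a.right B ≫ leftUnit B ≫ b.right ≅ overlapRight a b :=
  whiskerLeftIso (firstLayer a.right B) (leftUnitNat b.right).symm ≪≫
    (α_ _ _ _).symm ≪≫
    whiskerRightIso (interchange a.right b.right) (leftUnit unit) ≪≫
    whiskerLeftIso (secondLayer A b.right ≫ firstLayer a.right unit) unitIso ≪≫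
    α_ _ _ _ ≪≫
    whiskerLeftIso (secondLayer A b.right) (rightUnitNat a.right)

/-- The right boundary of `B` crosses the left boundary of `A`, so that the regions overlap. -/
def crossMiddle : b.right ≫ a.left ⟶
    (leftUnitInv B ≫ firstLayer a.left B) ≫ secondLayer A b.right ≫ rightUnit A :=
  𝟙 _ ⊗≫ (leftUnitAdj B).unit ▷ (b.right ≫ a.left) ⊗≫
    leftUnitInv B ◁ ((leftUnitNat b.right).inv ▷ a.left) ⊗≫
    (leftUnitInv B ≫ secondLayer unit b.right) ◁ (unitIso.hom ▷ a.left) ⊗≫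
    (leftUnitInv B ≫ secondLayer unit b.right) ◁ (rightUnitNat a.left).inv ⊗≫
    leftUnitInv B ◁ (interchange a.left b.right).inv ▷ rightUnit A ⊗≫ 𝟙 _

/-- The boundaries of the overlap `A ⊠ B`. The adjunction is composed from those of the two layers,
with the two right boundaries crossed. -/
def Boundary.overlap : Boundary (overlay A B) where
  left := overlapLeft a b
  right := overlapRight a b
  adj := adjunctionOfRightIso
    (b.adj.comp ((leftUnitAdj B).comp (firstLayerAdj a.adj B)))
    ((α_ _ _ _) ≪≫ crossRight a b)

/-- The 2-morphism built from three copies of `δ`: the partial transpose of `δ` on the two inner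
boundaries, then `δ` on the left strip and the converse of `δ` on the right strip, then the inner
boundaries cross. -/
def commOfComp (δ : a.strip ⟶ b.strip) : a.strip ≫ b.strip ⟶ (a.overlap b).strip :=
  𝟙 _ ⊗≫ a.left ◁ partialTranspose a b δ ▷ b.right ⊗≫ δ ▷ b.strip ≫ b.strip ◁ dag δ ⊗≫
    b.left ◁ crossMiddle a b ▷ a.right ⊗≫
    𝟙 ((b.left ≫ leftUnitInv B ≫ firstLayer a.left B) ≫
      (secondLayer A b.right ≫ rightUnit A ≫ a.right))

end Overlap

end Tensor

/-! Unitary 2-morphisms are closed under vertical composition and whiskering, and coherence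
isomorphisms are unitary. So `commOfComp` is unitary: its factors are δ', δ, δ† and the crossing χ,
which is built from unitary structure isomorphisms.

For the partial transpose λ', the point is that χ followed by gluing of the overlap can be rewritten
(`crossMiddle_glue`): cross the left boundaries, so that `l_A` comes first, glue A, cross back, and
glue B. Diagrammatically, wires in different layers slide past each other's arcs. This comes from
the strong naturality of the interchange and of the unitors (`naturality_mapAdjunction_counit`) and
is assembled in `cross_glue`, `cross_slide` and `cross_overlap_glue`.

After this rewriting each copy of δ in λ' is rotated separately (`commPartialTranspose_eq`). Gluing
A turns δ† into its partial transpose; the copy δ', closed off by creation of A and destruction of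
B, becomes a half turn of δ; and the copy δ, with separation of A and gluing of B, becomes δ'. Hence
λ' is `rotatedComp`, a composite of these three and of crossings of left boundaries.

Unitarity of δ' is assumed. For the other two, rotations are expressed by mates: a half turn is a
conjugate, so it reverses composites and preserves inverses, and equality of the two half turns
makes rotation compatible with the converse. -/

/-! ### Unitary 2-morphisms -/

section Unitary

variable {C : Type u} [Bicategory.{w, v} C] [DaggerBicategory C]

namespace IsUnitary

variable {a b c : C}

theorem id (f : a ⟶ b) : IsUnitary (𝟙 f) := by
  simp [IsUnitary, dag_id]

theorem comp {f g h : a ⟶ b} {α : f ⟶ g} {β : g ⟶ h} (hα : IsUnitary α) (hβ : IsUnitary β) :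
    IsUnitary (α ≫ β) := by
  constructor
  · rw [dag_comp, Category.assoc, ← Category.assoc β, hβ.1, Category.id_comp, hα.1]
  · rw [dag_comp, Category.assoc, ← Category.assoc _ α, hα.2, Category.id_comp, hβ.2]

theorem whiskerLeft (f : a ⟶ b) {g h : b ⟶ c} {α : g ⟶ h} (hα : IsUnitary α) :
    IsUnitary (f ◁ α) := by
  simp [IsUnitary, dag_whiskerLeft, ← Bicategory.whiskerLeft_comp, hα.1, hα.2]

theorem whiskerRight {f g : a ⟶ b} {α : f ⟶ g} (hα : IsUnitary α) (h : b ⟶ c) :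
    IsUnitary (α ▷ h) := by
  simp [IsUnitary, dag_whiskerRight, ← Bicategory.comp_whiskerRight, hα.1, hα.2]

theorem dag {f g : a ⟶ b} {α : f ⟶ g} (hα : IsUnitary α) : IsUnitary (dag α) := by
  simpa [IsUnitary, dag_dag] using And.symm hα

theorem dag_eq_inv {f g : a ⟶ b} {e : f ≅ g} (he : IsUnitary e.hom) :
    DaggerBicategory.dag e.hom = e.inv := by
  rw [← cancel_epi e.hom, he.1, e.hom_inv_id]

theorem inv {f g : a ⟶ b} {e : f ≅ g} (he : IsUnitary e.hom) : IsUnitary e.inv :=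
  he.dag_eq_inv ▸ he.dag

theorem associator {d : C} (f : a ⟶ b) (g : b ⟶ c) (h : c ⟶ d) : IsUnitary (α_ f g h).hom := by
  simp [IsUnitary, dag_associator]

theorem leftUnitor (f : a ⟶ b) : IsUnitary (λ_ f).hom := by
  simp [IsUnitary, dag_leftUnitor]

theorem rightUnitor (f : a ⟶ b) : IsUnitary (ρ_ f).hom := by
  simp [IsUnitary, dag_rightUnitor]

end IsUnitary

/-- The 2-morphism inserted by `⊗≫` is unitary. -/
class UnitaryCoherence {a b : C} (f g : a ⟶ b) [BicategoricalCoherence f g] : Prop where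
  isUnitary : IsUnitary (BicategoricalCoherence.iso : f ≅ g).hom

namespace UnitaryCoherence

variable {a b c d : C}

instance refl (f : a ⟶ b) : UnitaryCoherence f f := ⟨.id f⟩

instance whiskerLeft (f : a ⟶ b) (g h : b ⟶ c) [BicategoricalCoherence g h]
    [UnitaryCoherence g h] : UnitaryCoherence (f ≫ g) (f ≫ h) :=
  ⟨.whiskerLeft f isUnitary⟩

instance whiskerRight (f g : a ⟶ b) (h : b ⟶ c) [BicategoricalCoherence f g]
    [UnitaryCoherence f g] : UnitaryCoherence (f ≫ h) (g ≫ h) :=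
  ⟨.whiskerRight isUnitary h⟩

instance left (f g : a ⟶ b) [BicategoricalCoherence f g] [UnitaryCoherence f g] :
    UnitaryCoherence (𝟙 a ≫ f) g :=
  ⟨.comp (.leftUnitor f) isUnitary⟩

instance left' (f g : a ⟶ b) [BicategoricalCoherence f g] [UnitaryCoherence f g] :
    UnitaryCoherence f (𝟙 a ≫ g) :=
  ⟨.comp isUnitary (IsUnitary.leftUnitor g).inv⟩

instance assoc (f : a ⟶ b) (g : b ⟶ c) (h : c ⟶ d) (i : a ⟶ d)
    [BicategoricalCoherence (f ≫ g ≫ h) i] [UnitaryCoherence (f ≫ g ≫ h) i] :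
    UnitaryCoherence ((f ≫ g) ≫ h) i :=
  ⟨.comp (.associator f g h) isUnitary⟩

instance assoc' (f : a ⟶ b) (g : b ⟶ c) (h : c ⟶ d) (i : a ⟶ d)
    [BicategoricalCoherence i (f ≫ g ≫ h)] [UnitaryCoherence i (f ≫ g ≫ h)] :
    UnitaryCoherence i ((f ≫ g) ≫ h) :=
  ⟨.comp isUnitary (IsUnitary.associator f g h).inv⟩

end UnitaryCoherence

/-- Lets unitarity of a pasting be checked factor by factor, the inserted coherence being handled by
instance search. -/
theorem IsUnitary.bicategoricalComp {a b : C} {f g h i : a ⟶ b} [BicategoricalCoherence g h]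
    [UnitaryCoherence g h] {α : f ⟶ g} {β : h ⟶ i} (hα : IsUnitary α) (hβ : IsUnitary β) :
    IsUnitary (α ⊗≫ β) :=
  hα.comp (.comp UnitaryCoherence.isUnitary hβ)

end Unitary

/-! ### Rotations of δ as mates and conjugates. -/

section Rotation

variable {C : Type u} [Bicategory.{w, v} C] [DaggerBicategory C] [TensorBicategory C]
variable {A B : C} (a : Boundary A) (b : Boundary B)

theorem partialTranspose_eq_mate (δ : a.strip ⟶ b.strip) :
    partialTranspose a b δ = (Bicategory.mateEquiv (daggerAdjunction a.adj) b.adj).symm δ := by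
  rw [Bicategory.mateEquiv_symm_apply']
  simp only [partialTranspose, daggerAdjunction]
  bicategory

/-- The converse exchanges separation with gluing, so a mate taken backwards for one pair of
adjunctions becomes a mate taken forwards for the dagger pair. -/
theorem dag_partialTranspose (δ : a.strip ⟶ b.strip) :
    dag (partialTranspose a b δ) = Bicategory.mateEquiv a.adj (daggerAdjunction b.adj) (dag δ) := by
  rw [Bicategory.mateEquiv_apply']
  simp [partialTranspose, daggerAdjunction, bicategoricalComp, dag_comp, dag_whiskerLeft,
      dag_whiskerRight, dag_associator, dag_associator_inv, dag_leftUnitor_inv,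
      dag_rightUnitor, dag_dag]

/-- A half turn is two quarter turns in the same direction; iterated mates are conjugates for the
composite adjunctions, whose units and counits are the cups and caps of strips. -/
theorem halfTurnClockwise_eq_mate (δ : a.strip ⟶ b.strip) :
    halfTurnClockwise a b δ =
      (Bicategory.mateEquiv a.adj (daggerAdjunction b.adj)).symm (partialTranspose a b δ) := by
  rw [partialTranspose_eq_mate, Bicategory.iterated_mateEquiv_conjugateEquiv_symm, Bicategory.conjugateEquiv_symm_apply']
  simp only [halfTurnClockwise, Boundary.cup, Boundary.cap, daggerAdjunction, Bicategory.Adjunction.comp,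
    Bicategory.Adjunction.compUnit, Bicategory.Adjunction.compCounit]
  bicategory

theorem halfTurnAnticlockwise_eq_mate (δ : a.strip ⟶ b.strip) :
    halfTurnAnticlockwise a b δ =
      Bicategory.mateEquiv (daggerAdjunction b.adj) a.adj (Bicategory.mateEquiv b.adj (daggerAdjunction a.adj) δ) := by
  rw [Bicategory.iterated_mateEquiv_conjugateEquiv, Bicategory.conjugateEquiv_apply']
  simp only [halfTurnAnticlockwise, Boundary.cup, Boundary.cap, daggerAdjunction, Bicategory.Adjunction.comp,
    Bicategory.Adjunction.compUnit, Bicategory.Adjunction.compCounit]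
  bicategory

theorem halfTurnClockwise_eq_conjugate (δ : a.strip ⟶ b.strip) :
    halfTurnClockwise a b δ =
      (Bicategory.conjugateEquiv (a.adj.comp (daggerAdjunction a.adj))
        (b.adj.comp (daggerAdjunction b.adj))).symm δ := by
  rw [halfTurnClockwise_eq_mate, partialTranspose_eq_mate, Bicategory.iterated_mateEquiv_conjugateEquiv_symm]

/-- Reflection in a horizontal line reverses the sense of rotation. -/
theorem dag_halfTurnAnticlockwise (δ : a.strip ⟶ b.strip) :
    dag (halfTurnAnticlockwise a b δ) = halfTurnClockwise b a (dag δ) := by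
  simp [halfTurnClockwise, halfTurnAnticlockwise, Boundary.cup, Boundary.cap,
      bicategoricalComp, dag_comp, dag_whiskerLeft,
      dag_whiskerRight, dag_associator, dag_associator_inv, dag_leftUnitor, dag_leftUnitor_inv,
      dag_rightUnitor_inv, dag_dag]

variable {a b}

/-- The half turn of a rotatable unitary vertex is unitary. -/
theorem IsRotatable.isUnitary_halfTurnClockwise {δ : a.strip ⟶ b.strip} (hrot : IsRotatable a b δ)
    (hδ : IsUnitary δ) : IsUnitary (halfTurnClockwise a b δ) := by
  -- Rotatability enters here: the converse alone would give the half turn of `dag δ` in the other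
  -- direction.
  have h : dag (halfTurnClockwise a b δ) = halfTurnClockwise b a (dag δ) := by
    rw [hrot, dag_halfTurnAnticlockwise]
  rw [IsUnitary, h, halfTurnClockwise_eq_conjugate, halfTurnClockwise_eq_conjugate]
  exact ⟨Bicategory.conjugateEquiv_symm_comm _ _ hδ.2, Bicategory.conjugateEquiv_symm_comm _ _ hδ.1⟩

/-- The partial transpose of the converse of a rotatable complementary structure is unitary. -/
theorem IsRotatable.isUnitary_partialTranspose_dag {δ : a.strip ⟶ b.strip}
    (hrot : IsRotatable a b δ) (hδ : IsUnitary (partialTranspose a b δ)) :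
    IsUnitary (partialTranspose b a (dag δ)) := by
  have h₁ : partialTranspose b a (dag δ) = (Bicategory.conjugateEquiv
      ((daggerAdjunction b.adj).comp a.adj) ((daggerAdjunction b.adj).comp a.adj)).symm
        (dag (partialTranspose a b δ)) := by
    rw [← Bicategory.iterated_mateEquiv_conjugateEquiv_symm, dag_partialTranspose, Equiv.symm_apply_apply,
      partialTranspose_eq_mate]
  -- Rotating δ' on by two clockwise quarter turns makes three quarter turns of δ in all; since the
  -- half turns agree, this is one anticlockwise quarter turn.
  have h₂ : dag (partialTranspose b a (dag δ)) = (Bicategory.conjugateEquiv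
      ((daggerAdjunction b.adj).comp a.adj) ((daggerAdjunction b.adj).comp a.adj)).symm
        (partialTranspose a b δ) := by
    rw [← Bicategory.iterated_mateEquiv_conjugateEquiv_symm, dag_partialTranspose, dag_dag,
      ← halfTurnClockwise_eq_mate, hrot, halfTurnAnticlockwise_eq_mate, Equiv.symm_apply_apply]
  rw [IsUnitary, h₂, h₁]
  exact ⟨Bicategory.conjugateEquiv_symm_comm _ _ hδ.1, Bicategory.conjugateEquiv_symm_comm _ _ hδ.2⟩

end Rotation

/-! ### Strong transformations and adjunctions -/

section StrongTrans

universe w₁ w₂ w₃ v₁ v₂ v₃ u₁ u₂ u₃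

variable {B : Type u₁} [Bicategory.{w₁, v₁} B] {C : Type u₂} [Bicategory.{w₂, v₂} C]
  {D : Type u₃} [Bicategory.{w₃, v₃} D]

namespace CategoryTheory.Pseudofunctor

variable (H : C ⥤ᵖ D)

/-- The image under a pseudofunctor of a square filled by a 2-isomorphism. -/
def mapSquare {a b c d : C} {f : a ⟶ b} {g : b ⟶ d} {h : a ⟶ c} {k : c ⟶ d}
    (e : f ≫ g ≅ h ≫ k) : H.map f ≫ H.map g ≅ H.map h ≫ H.map k :=
  (H.mapComp f g).symm ≪≫ H.map₂Iso e ≪≫ H.mapComp h k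

/-- This and the next two lemmas are the axioms of a strong transformation, stated for bare squares
so that `whiskerPseudofunctor` can apply them to each component. -/
theorem mapSquare_naturality {a b c d : C} {f f' : a ⟶ b} {g : b ⟶ d} {h : a ⟶ c} {k k' : c ⟶ d}
    {e : f ≫ g ≅ h ≫ k} {e' : f' ≫ g ≅ h ≫ k'} {α : f ⟶ f'} {β : k ⟶ k'}
    (w : α ▷ g ≫ e'.hom = e.hom ≫ h ◁ β) :
    H.map₂ α ▷ H.map g ≫ (H.mapSquare e').hom = (H.mapSquare e).hom ≫ H.map h ◁ H.map₂ β := by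
  have h := congrArg H.map₂ w
  rw [H.map₂_comp, H.map₂_comp, H.map₂_whisker_left, H.map₂_whisker_right] at h
  rw [← cancel_epi (H.mapComp _ _).hom, ← cancel_mono (H.mapComp _ _).inv]
  simpa [mapSquare] using h

theorem mapSquare_id {a b : C} {k : a ⟶ b} {f : a ⟶ a} {f' : b ⟶ b} (i : f ≅ 𝟙 a) (i' : f' ≅ 𝟙 b)
    {e : f ≫ k ≅ k ≫ f'} (w : e.hom ≫ k ◁ i'.hom = i.hom ▷ k ≫ (λ_ k).hom ≫ (ρ_ k).inv) :
    (H.mapSquare e).hom ≫ H.map k ◁ (H.map₂Iso i' ≪≫ H.mapId b).hom =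
      (H.map₂Iso i ≪≫ H.mapId a).hom ▷ H.map k ≫ (λ_ (H.map k)).hom ≫ (ρ_ (H.map k)).inv := by
  have h := congrArg H.map₂ w
  simp only [H.map₂_comp, H.map₂_whisker_left, H.map₂_whisker_right] at h
  rw [← cancel_epi (H.mapComp _ _).hom]
  rw [← cancel_mono (H.mapComp _ _).hom] at h
  simp [mapSquare] at h ⊢
  rw [reassoc_of% h, H.whiskerLeft_mapId_hom, Iso.hom_inv_id_assoc, H.map₂_inv_hom_assoc]

theorem mapSquare_comp {a b c x y z : C} {f : a ⟶ b} {g : b ⟶ c} {l : a ⟶ c} {f' : x ⟶ y}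
    {g' : y ⟶ z} {l' : x ⟶ z} {p : a ⟶ x} {q : b ⟶ y} {r : c ⟶ z}
    {m : l ≅ f ≫ g} {m' : l' ≅ f' ≫ g'} {e₁ : f ≫ q ≅ p ≫ f'} {e₂ : g ≫ r ≅ q ≫ g'}
    {e : l ≫ r ≅ p ≫ l'}
    (w : e.hom ≫ p ◁ m'.hom = m.hom ▷ r ≫ (α_ _ _ _).hom ≫ f ◁ e₂.hom ≫ (α_ _ _ _).inv ≫
      e₁.hom ▷ g' ≫ (α_ _ _ _).hom) :
    (H.mapSquare e).hom ≫ H.map p ◁ (H.map₂Iso m' ≪≫ H.mapComp f' g').hom =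
      (H.map₂Iso m ≪≫ H.mapComp f g).hom ▷ H.map r ≫ (α_ _ _ _).hom ≫
        H.map f ◁ (H.mapSquare e₂).hom ≫ (α_ _ _ _).inv ≫
        (H.mapSquare e₁).hom ▷ H.map g' ≫ (α_ _ _ _).hom := by
  have hassoc : H.map₂ (α_ f q g').inv = (H.mapComp f (q ≫ g')).hom ≫
      H.map f ◁ (H.mapComp q g').hom ≫ (α_ _ _ _).inv ≫ (H.mapComp f q).inv ▷ H.map g' ≫
        (H.mapComp (f ≫ q) g').inv := by
    rw [H.mapComp_assoc_right_hom_assoc]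
    simp
  have h := congrArg H.map₂ w
  simp only [H.map₂_comp, H.map₂_whisker_left, H.map₂_whisker_right, H.map₂_associator,
    hassoc] at h
  rw [← cancel_epi (H.mapComp _ _).hom]
  rw [← cancel_mono ((H.mapComp _ _).hom), Category.assoc, Category.assoc] at h
  simp [mapSquare] at h ⊢
  rw [reassoc_of% h]
  simp

end CategoryTheory.Pseudofunctor

/-- Whiskering of a strong transformation by a pseudofunctor. -/
def CategoryTheory.Pseudofunctor.StrongTrans.whiskerPseudofunctor {F G : B ⥤ᵖ C}
    (η : Pseudofunctor.StrongTrans F G) (H : C ⥤ᵖ D) :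
    Pseudofunctor.StrongTrans (F.comp H) (G.comp H) where
  app X := H.map (η.app X)
  naturality f := H.mapSquare (η.naturality f)
  naturality_naturality θ := H.mapSquare_naturality (η.naturality_naturality θ)
  naturality_id a := H.mapSquare_id (F.mapId a) (G.mapId a) (η.naturality_id a)
  naturality_comp f g := H.mapSquare_comp (m := F.mapComp f g) (m' := G.mapComp f g)
    (η.naturality_comp f g)

/-- The counit of a mapped adjunction is a composite of `mapComp`, the image of the counit and
`mapId`; the three axioms of a strong transformation move the component of η past these one at a
time. -/
theorem CategoryTheory.Pseudofunctor.StrongTrans.naturality_mapAdjunction_counit {F G : B ⥤ᵖ C}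
    (η : Pseudofunctor.StrongTrans F G) {a b : B} {f : a ⟶ b} {g : b ⟶ a} (adj : f ⊣ g) :
    F.map g ◁ (η.naturality f).hom ⊗≫ (η.naturality g).hom ▷ G.map f ⊗≫
      η.app b ◁ (G.mapAdjunction adj).counit =
      𝟙 _ ⊗≫ (F.mapAdjunction adj).counit ▷ η.app b ⊗≫ 𝟙 _ := by
  have h₁ := η.naturality_comp g f
  have h₂ := η.naturality_naturality adj.counit
  have h₃ := η.naturality_id b
  have e : F.map g ◁ (η.naturality f).hom ⊗≫ (η.naturality g).hom ▷ G.map f ⊗≫ 𝟙 _ =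
    𝟙 _ ⊗≫ (F.mapComp g f).inv ▷ η.app b ≫ (η.naturality (g ≫ f)).hom ≫
        η.app b ◁ (G.mapComp g f).hom := by
    rw [h₁]; simp [bicategoricalComp]
  calc
    _ = (F.map g ◁ (η.naturality f).hom ⊗≫ (η.naturality g).hom ▷ G.map f ⊗≫ 𝟙 _) ≫
        η.app b ◁ (G.mapAdjunction adj).counit := by bicategory
    _ = 𝟙 _ ⊗≫ (F.mapComp g f).inv ▷ η.app b ≫ (η.naturality (g ≫ f)).hom ≫
        η.app b ◁ G.map₂ adj.counit ≫ η.app b ◁ (G.mapId b).hom := by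
      rw [e]
      simp only [bicategoricalComp, Category.assoc, Pseudofunctor.mapAdjunction_counit,
        Bicategory.whiskerLeft_comp, whiskerLeft_hom_inv_assoc]
    _ = 𝟙 _ ⊗≫ (F.mapComp g f).inv ▷ η.app b ≫ F.map₂ adj.counit ▷ η.app b ≫
          (η.naturality (𝟙 b)).hom ≫ η.app b ◁ (G.mapId b).hom := by
      rw [reassoc_of% h₂]
    _ = _ := by
      rw [h₃]; simp [bicategoricalComp]

theorem CategoryTheory.Pseudofunctor.StrongTrans.naturality_inv_mapAdjunction_counit {F G : B ⥤ᵖ C}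
    (η : Pseudofunctor.StrongTrans F G) {a b : B} {f : a ⟶ b} {g : b ⟶ a} (adj : f ⊣ g) :
    F.map g ◁ (η.naturality f).inv ⊗≫ (F.mapAdjunction adj).counit ▷ η.app b ⊗≫ 𝟙 (η.app b) =
      𝟙 _ ⊗≫ (η.naturality g).hom ▷ G.map f ⊗≫ η.app b ◁ (G.mapAdjunction adj).counit ⊗≫ 𝟙 _ := by
  calc
    _ = F.map g ◁ (η.naturality f).inv ≫
        (𝟙 (F.map g ≫ F.map f ≫ η.app b) ⊗≫ (F.mapAdjunction adj).counit ▷ η.app b ⊗≫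
          𝟙 (η.app b ≫ 𝟙 (G.obj b))) ⊗≫ 𝟙 _ := by bicategory
    _ = F.map g ◁ ((η.naturality f).inv ≫ (η.naturality f).hom) ⊗≫
        (η.naturality g).hom ▷ G.map f ⊗≫ η.app b ◁ (G.mapAdjunction adj).counit ⊗≫ 𝟙 _ := by
      rw [← η.naturality_mapAdjunction_counit adj]
      bicategory
    _ = _ := by
      rw [Iso.inv_hom_id]
      bicategory

theorem CategoryTheory.Pseudofunctor.StrongTrans.naturality_inv_inv_mapAdjunction_counit
    {F G : B ⥤ᵖ C} (η : Pseudofunctor.StrongTrans F G) {a b : B} {f : a ⟶ b} {g : b ⟶ a}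
    (adj : f ⊣ g) :
    (η.naturality g).inv ▷ G.map f ⊗≫ F.map g ◁ (η.naturality f).inv ⊗≫
      (F.mapAdjunction adj).counit ▷ η.app b ⊗≫ 𝟙 (η.app b) =
      𝟙 _ ⊗≫ η.app b ◁ (G.mapAdjunction adj).counit ⊗≫ 𝟙 _ := by
  calc
    _ = (η.naturality g).inv ▷ G.map f ⊗≫ (F.map g ◁ (η.naturality f).inv ⊗≫
      (F.mapAdjunction adj).counit ▷ η.app b ⊗≫ 𝟙 _) := by bicategory
    _ = ((η.naturality g).inv ≫ (η.naturality g).hom) ▷ G.map f ⊗≫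
        η.app b ◁ (G.mapAdjunction adj).counit ⊗≫ 𝟙 _ := by
      rw [η.naturality_inv_mapAdjunction_counit adj]
      bicategory
    _ = _ := by
      rw [Iso.inv_hom_id]
      bicategory

end StrongTrans

/-! ### Naturality of the interchange isomorphism -/

section Interchange

variable {C : Type u} [Bicategory.{w, v} C]

/-- Morphisms of the two factors of a product commute: naturality in the first factor. -/
def sectLTrans {Y Y' : C} (h : Y ⟶ Y') : Pseudofunctor.StrongTrans
    (Prod.sectL C Y).toPseudofunctor (Prod.sectL C Y').toPseudofunctor where
  app X := (𝟙 X, h)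
  naturality f := Iso.prod (ρ_ f ≪≫ (λ_ f).symm) (λ_ h ≪≫ (ρ_ h).symm)
  naturality_naturality {X X'} f g θ := by
    apply Prod.ext
    · change θ ▷ 𝟙 X' ≫ (ρ_ g).hom ≫ (λ_ g).inv = ((ρ_ f).hom ≫ (λ_ f).inv) ≫ 𝟙 X ◁ θ
      bicategory
    · change 𝟙 (𝟙 Y) ▷ h ≫ (λ_ h).hom ≫ (ρ_ h).inv = ((λ_ h).hom ≫ (ρ_ h).inv) ≫ h ◁ 𝟙 (𝟙 Y')
      bicategory
  naturality_id X := by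
    apply Prod.ext
    · change ((ρ_ (𝟙 X)).hom ≫ (λ_ (𝟙 X)).inv) ≫ 𝟙 X ◁ 𝟙 (𝟙 X) =
        𝟙 (𝟙 X) ▷ 𝟙 X ≫ (λ_ (𝟙 X)).hom ≫ (ρ_ (𝟙 X)).inv
      bicategory
    · change ((λ_ h).hom ≫ (ρ_ h).inv) ≫ h ◁ 𝟙 (𝟙 Y') = 𝟙 (𝟙 Y) ▷ h ≫ (λ_ h).hom ≫ (ρ_ h).inv
      bicategory
  naturality_comp {X₁ X₂ X₃} f g := by
    apply Prod.ext
    · change ((ρ_ (f ≫ g)).hom ≫ (λ_ (f ≫ g)).inv) ≫ 𝟙 X₁ ◁ 𝟙 (f ≫ g) =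
        𝟙 (f ≫ g) ▷ 𝟙 X₃ ≫ (α_ f g (𝟙 X₃)).hom ≫ f ◁ ((ρ_ g).hom ≫ (λ_ g).inv) ≫
          (α_ f (𝟙 X₂) g).inv ≫ ((ρ_ f).hom ≫ (λ_ f).inv) ▷ g ≫ (α_ (𝟙 X₁) f g).hom
      bicategory
    · change ((λ_ h).hom ≫ (ρ_ h).inv) ≫ h ◁ (λ_ (𝟙 Y')).inv =
        (λ_ (𝟙 Y)).inv ▷ h ≫ (α_ (𝟙 Y) (𝟙 Y) h).hom ≫ 𝟙 Y ◁ ((λ_ h).hom ≫ (ρ_ h).inv) ≫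
          (α_ (𝟙 Y) h (𝟙 Y')).inv ≫ ((λ_ h).hom ≫ (ρ_ h).inv) ▷ 𝟙 Y' ≫
          (α_ h (𝟙 Y') (𝟙 Y')).hom
      bicategory

/-- Morphisms of the two factors of a product commute: naturality in the second factor. -/
def sectRTrans {X X' : C} (k : X ⟶ X') : Pseudofunctor.StrongTrans
    (Prod.sectR X C).toPseudofunctor (Prod.sectR X' C).toPseudofunctor where
  app Y := (k, 𝟙 Y)
  naturality g := Iso.prod (λ_ k ≪≫ (ρ_ k).symm) (ρ_ g ≪≫ (λ_ g).symm)
  naturality_naturality {Y Y'} f g θ := by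
    apply Prod.ext
    · change 𝟙 (𝟙 X) ▷ k ≫ (λ_ k).hom ≫ (ρ_ k).inv = ((λ_ k).hom ≫ (ρ_ k).inv) ≫ k ◁ 𝟙 (𝟙 X')
      bicategory
    · change θ ▷ 𝟙 Y' ≫ (ρ_ g).hom ≫ (λ_ g).inv = ((ρ_ f).hom ≫ (λ_ f).inv) ≫ 𝟙 Y ◁ θ
      bicategory
  naturality_id Y := by
    apply Prod.ext
    · change ((λ_ k).hom ≫ (ρ_ k).inv) ≫ k ◁ 𝟙 (𝟙 X') = 𝟙 (𝟙 X) ▷ k ≫ (λ_ k).hom ≫ (ρ_ k).inv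
      bicategory
    · change ((ρ_ (𝟙 Y)).hom ≫ (λ_ (𝟙 Y)).inv) ≫ 𝟙 Y ◁ 𝟙 (𝟙 Y) =
        𝟙 (𝟙 Y) ▷ 𝟙 Y ≫ (λ_ (𝟙 Y)).hom ≫ (ρ_ (𝟙 Y)).inv
      bicategory
  naturality_comp {Y₁ Y₂ Y₃} f g := by
    apply Prod.ext
    · change ((λ_ k).hom ≫ (ρ_ k).inv) ≫ k ◁ (ρ_ (𝟙 X')).inv =
        (ρ_ (𝟙 X)).inv ▷ k ≫ (α_ (𝟙 X) (𝟙 X) k).hom ≫ 𝟙 X ◁ ((λ_ k).hom ≫ (ρ_ k).inv) ≫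
          (α_ (𝟙 X) k (𝟙 X')).inv ≫ ((λ_ k).hom ≫ (ρ_ k).inv) ▷ 𝟙 X' ≫
          (α_ k (𝟙 X') (𝟙 X')).hom
      bicategory
    · change ((ρ_ (f ≫ g)).hom ≫ (λ_ (f ≫ g)).inv) ≫ 𝟙 Y₁ ◁ 𝟙 (f ≫ g) =
        𝟙 (f ≫ g) ▷ 𝟙 Y₃ ≫ (α_ f g (𝟙 Y₃)).hom ≫ f ◁ ((ρ_ g).hom ≫ (λ_ g).inv) ≫
          (α_ f (𝟙 Y₂) g).inv ≫ ((ρ_ f).hom ≫ (λ_ f).inv) ▷ g ≫ (α_ (𝟙 Y₁) f g).hom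
      bicategory

variable [DaggerBicategory C] [TensorBicategory C]

/-- The adjunction in the second layer. -/
def secondLayerAdj (X : C) {Y Y' : C} {f : Y ⟶ Y'} {g : Y' ⟶ Y} (adj : f ⊣ g) :
    secondLayer X f ⊣ secondLayer X g :=
  (leftSheet X).mapAdjunction adj

/-- Interchange with a fixed wire in the second layer, natural in the first layer. -/
def interchangeTransFirst {Y Y' : C} (h : Y ⟶ Y') :
    Pseudofunctor.StrongTrans (rightSheet Y) (rightSheet Y') :=
  (sectLTrans h).whiskerPseudofunctor tensor

/-- Interchange with a fixed wire in the first layer, natural in the second layer. -/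
def interchangeTransSecond {X X' : C} (k : X ⟶ X') :
    Pseudofunctor.StrongTrans (leftSheet X) (leftSheet X') :=
  (sectRTrans k).whiskerPseudofunctor tensor

/-- The same crossing is natural in either layer, but the naturality square for the second layer
runs in the opposite direction. -/
theorem interchange_eq_second {X X' Y Y' : C} (f : X ⟶ X') (g : Y ⟶ Y') :
    (interchange f g).symm = (interchangeTransSecond f).naturality g := by
  ext
  exact Category.assoc _ _ _

/-- An arc in the first layer slides past the wire `h` in the second. -/
theorem interchange_inv_glue {X X' Y Y' : C} {f : X ⟶ X'} {g : X' ⟶ X} (adj : f ⊣ g) (h : Y ⟶ Y') :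
    (interchange g h).inv ▷ firstLayer f Y' ⊗≫ firstLayer g Y ◁ (interchange f h).inv ⊗≫
      (firstLayerAdj adj Y).counit ▷ secondLayer X' h ⊗≫ 𝟙 (secondLayer X' h) =
      𝟙 _ ⊗≫ secondLayer X' h ◁ (firstLayerAdj adj Y').counit ⊗≫ 𝟙 _ :=
  (interchangeTransFirst h).naturality_inv_inv_mapAdjunction_counit adj

theorem interchange_hom_glue {X X' Y Y' : C} {f : Y ⟶ Y'} {g : Y' ⟶ Y} (adj : f ⊣ g) (k : X ⟶ X') :
    secondLayer X g ◁ (interchange k f).hom ⊗≫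
      (secondLayerAdj X adj).counit ▷ firstLayer k Y' ⊗≫ 𝟙 (firstLayer k Y') =
      𝟙 _ ⊗≫ (interchange k g).inv ▷ secondLayer X' f ⊗≫
        firstLayer k Y' ◁ (secondLayerAdj X' adj).counit ⊗≫ 𝟙 _ := by
  have h := (interchangeTransSecond k).naturality_inv_mapAdjunction_counit adj
  rw [← interchange_eq_second, ← interchange_eq_second] at h
  exact h

theorem rightUnitNat_inv_glue {X Y : C} {f : X ⟶ Y} {g : Y ⟶ X} (adj : f ⊣ g) :
    (rightUnitNat g).inv ▷ f ⊗≫ firstLayer g unit ◁ (rightUnitNat f).inv ⊗≫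
      (firstLayerAdj adj unit).counit ▷ rightUnit Y ⊗≫ 𝟙 (rightUnit Y) =
      𝟙 _ ⊗≫ rightUnit Y ◁ adj.counit ⊗≫ 𝟙 _ := by
  have h := (rightUnitor (C := C)).naturality_inv_inv_mapAdjunction_counit adj
  -- The identity pseudofunctor has identity structure 2-morphisms.
  have e : ((Pseudofunctor.id C).mapAdjunction adj).counit = adj.counit :=
    (Category.id_comp _).trans (Category.comp_id _)
  rw [e] at h
  exact h

theorem leftUnitNat_inv_glue {X Y : C} {f : X ⟶ Y} {g : Y ⟶ X} (adj : f ⊣ g) :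
    secondLayer unit g ◁ (leftUnitNat f).inv ⊗≫
      (secondLayerAdj unit adj).counit ▷ leftUnit Y ⊗≫ 𝟙 (leftUnit Y) =
      𝟙 _ ⊗≫ (leftUnitNat g).hom ▷ f ⊗≫ leftUnit Y ◁ adj.counit ⊗≫ 𝟙 _ := by
  have h := (leftUnitor (C := C)).naturality_inv_mapAdjunction_counit adj
  have e : ((Pseudofunctor.id C).mapAdjunction adj).counit = adj.counit :=
    (Category.id_comp _).trans (Category.comp_id _)
  rw [e] at h
  exact h

end Interchange

/-! ### Pasting lemmas for crossing wires -/

section Pasting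

variable {C : Type u} [Bicategory.{w, v} C]

/-- Straightening a wire: bending `Θ` by the unit and then by the counit of an adjunction. -/
theorem counit_unit_straighten {X Y Z : C} {l : X ⟶ Y} {r : Y ⟶ X} (adj : l ⊣ r) {g : X ⟶ Z}
    {h : Y ⟶ Z} (Θ : r ≫ g ⟶ h) :
    r ◁ (𝟙 g ⊗≫ adj.unit ▷ g ⊗≫ l ◁ Θ) ⊗≫ adj.counit ▷ h ⊗≫ 𝟙 h = Θ := by
  calc
    _ = adj.homEquiv₁ (adj.homEquiv₁.symm Θ) := by
      rw [Bicategory.Adjunction.homEquiv₁_apply, Bicategory.Adjunction.homEquiv₁_symm_apply]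
      bicategory
    _ = Θ := Equiv.apply_symm_apply _ _

/-- A wire crossing both ends of an arc crosses the arc. -/
theorem cross_glue {U A B D UB AU UU : C} {rA : A ⟶ U} {lA : U ⟶ A} {rB : B ⟶ U}
    {lamB : UB ⟶ B} {lamB' : B ⟶ UB} {lamU : UU ⟶ U} {rhoA : AU ⟶ A} {rhoU : UU ⟶ U}
    {rAB : D ⟶ UB} {lAB : UB ⟶ D} {rAU : AU ⟶ UU} {lAU : UU ⟶ AU} {ArB : D ⟶ AU} {UrB : UB ⟶ UU}
    (u : lamU ≅ rhoU) (nl : UrB ≫ lamU ≅ lamB ≫ rB) (nr : rAU ≫ rhoU ≅ rhoA ≫ rA)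
    (nr' : lAU ≫ rhoA ≅ rhoU ≫ lA) (i : rAB ≫ UrB ≅ ArB ≫ rAU) (i' : lAB ≫ ArB ≅ UrB ≫ lAU)
    (adj : lamB' ⊣ lamB) (gA : rA ≫ lA ⟶ 𝟙 A) (gAB : rAB ≫ lAB ⟶ 𝟙 D) (gAU : rAU ≫ lAU ⟶ 𝟙 AU)
    (hr : nr.inv ▷ lA ⊗≫ rAU ◁ nr'.inv ⊗≫ gAU ▷ rhoA ⊗≫ 𝟙 rhoA = 𝟙 _ ⊗≫ rhoA ◁ gA ⊗≫ 𝟙 _)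
    (hi : i.inv ▷ lAU ⊗≫ rAB ◁ i'.inv ⊗≫ gAB ▷ ArB ⊗≫ 𝟙 ArB = 𝟙 _ ⊗≫ ArB ◁ gAU ⊗≫ 𝟙 _) :
    (𝟙 (ArB ≫ rhoA ≫ rA) ⊗≫ ArB ◁ nr.inv ⊗≫ (ArB ≫ rAU) ◁ u.inv ⊗≫ i.inv ▷ lamU ⊗≫
        rAB ◁ nl.hom) ▷ lA ⊗≫
      (rAB ≫ lamB) ◁ (𝟙 (rB ≫ lA) ⊗≫ adj.unit ▷ (rB ≫ lA) ⊗≫ lamB' ◁ (nl.inv ▷ lA) ⊗≫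
        (lamB' ≫ UrB) ◁ (u.hom ▷ lA) ⊗≫ (lamB' ≫ UrB) ◁ nr'.inv ⊗≫ lamB' ◁ i'.inv ▷ rhoA ⊗≫
          𝟙 ((lamB' ≫ lAB) ≫ ArB ≫ rhoA)) ⊗≫
      rAB ◁ adj.counit ▷ (lAB ≫ ArB ≫ rhoA) ⊗≫ gAB ▷ (ArB ≫ rhoA) ⊗≫ 𝟙 (ArB ≫ rhoA) =
    𝟙 _ ⊗≫ (ArB ≫ rhoA) ◁ gA ⊗≫ 𝟙 _ := by
  -- The unit of `adj` inside χ and the counit in the gluing straighten the inverse unitor of B.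
  -- After this, `nl` and `u` cancel against their inverses, and only `hi` and `hr` are needed.
  have key : lamB ◁ (𝟙 (rB ≫ lA) ⊗≫ adj.unit ▷ (rB ≫ lA) ⊗≫
      lamB' ◁ (𝟙 (lamB ≫ rB ≫ lA) ⊗≫ nl.inv ▷ lA ⊗≫ UrB ◁ (u.hom ▷ lA) ⊗≫ UrB ◁ nr'.inv ⊗≫
        i'.inv ▷ rhoA ⊗≫ 𝟙 (lAB ≫ ArB ≫ rhoA))) ⊗≫ adj.counit ▷ (lAB ≫ ArB ≫ rhoA) ⊗≫
          𝟙 (lAB ≫ ArB ≫ rhoA) =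
      𝟙 (lamB ≫ rB ≫ lA) ⊗≫ nl.inv ▷ lA ⊗≫ UrB ◁ (u.hom ▷ lA) ⊗≫ UrB ◁ nr'.inv ⊗≫
        i'.inv ▷ rhoA ⊗≫ 𝟙 (lAB ≫ ArB ≫ rhoA) := by
    refine Eq.trans ?_ (counit_unit_straighten adj _)
    bicategory
  calc
    _ = (𝟙 (ArB ≫ rhoA ≫ rA) ⊗≫ ArB ◁ nr.inv ⊗≫ (ArB ≫ rAU) ◁ u.inv ⊗≫ i.inv ▷ lamU ⊗≫
        rAB ◁ nl.hom) ▷ lA ⊗≫ rAB ◁ (lamB ◁ (𝟙 (rB ≫ lA) ⊗≫ adj.unit ▷ (rB ≫ lA) ⊗≫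
          lamB' ◁ (𝟙 (lamB ≫ rB ≫ lA) ⊗≫ nl.inv ▷ lA ⊗≫ UrB ◁ (u.hom ▷ lA) ⊗≫ UrB ◁ nr'.inv ⊗≫
            i'.inv ▷ rhoA ⊗≫ 𝟙 (lAB ≫ ArB ≫ rhoA))) ⊗≫ adj.counit ▷ (lAB ≫ ArB ≫ rhoA) ⊗≫
              𝟙 (lAB ≫ ArB ≫ rhoA)) ⊗≫ gAB ▷ (ArB ≫ rhoA) ⊗≫ 𝟙 (ArB ≫ rhoA) := by bicategory
    _ = 𝟙 _ ⊗≫ ArB ◁ nr.inv ▷ lA ⊗≫ ((ArB ≫ rAU) ◁ u.inv ≫ i.inv ▷ lamU) ▷ lA ⊗≫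
        rAB ◁ (nl.hom ≫ nl.inv) ▷ lA ⊗≫ (rAB ≫ UrB) ◁ (u.hom ▷ lA) ⊗≫ (rAB ≫ UrB) ◁ nr'.inv ⊗≫
          rAB ◁ i'.inv ▷ rhoA ⊗≫ gAB ▷ (ArB ≫ rhoA) ⊗≫ 𝟙 (ArB ≫ rhoA) := by
      rw [key]; bicategory
    _ = 𝟙 _ ⊗≫ ArB ◁ nr.inv ▷ lA ⊗≫ i.inv ▷ rhoU ▷ lA ⊗≫ (rAB ≫ UrB) ◁ (u.inv ≫ u.hom) ▷ lA ⊗≫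
          (rAB ≫ UrB) ◁ nr'.inv ⊗≫
          rAB ◁ i'.inv ▷ rhoA ⊗≫ gAB ▷ (ArB ≫ rhoA) ⊗≫ 𝟙 (ArB ≫ rhoA) := by
      rw [whisker_exchange, Iso.hom_inv_id]; bicategory
    _ = 𝟙 _ ⊗≫ ArB ◁ nr.inv ▷ lA ⊗≫ (i.inv ▷ (rhoU ≫ lA) ≫ (rAB ≫ UrB) ◁ nr'.inv) ⊗≫
          rAB ◁ i'.inv ▷ rhoA ⊗≫ gAB ▷ (ArB ≫ rhoA) ⊗≫ 𝟙 (ArB ≫ rhoA) := by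
      rw [Iso.inv_hom_id]; bicategory
    _ = 𝟙 _ ⊗≫ ArB ◁ (nr.inv ▷ lA ⊗≫ rAU ◁ nr'.inv) ⊗≫
          (i.inv ▷ lAU ⊗≫ rAB ◁ i'.inv ⊗≫ gAB ▷ ArB ⊗≫ 𝟙 ArB) ▷ rhoA ⊗≫ 𝟙 (ArB ≫ rhoA) := by
      rw [← whisker_exchange]; bicategory
    _ = 𝟙 _ ⊗≫ ArB ◁ (nr.inv ▷ lA ⊗≫ rAU ◁ nr'.inv ⊗≫ gAU ▷ rhoA ⊗≫ 𝟙 rhoA) ⊗≫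
          𝟙 (ArB ≫ rhoA) := by
      rw [hi]; bicategory
    _ = _ := by
      rw [hr]; bicategory

/-- Moving a 2-morphism across an adjoint equivalence. -/
theorem conj_equivalence {X Y Z : C} {l : X ⟶ Y} {r : Y ⟶ X} (adj : l ⊣ r) {η' : l ≫ r ⟶ 𝟙 X}
    (h : η' ≫ adj.unit = 𝟙 _) {x y : X ⟶ Z} (Z₀ : r ≫ x ⟶ r ≫ y) :
    r ◁ (𝟙 x ⊗≫ adj.unit ▷ x ⊗≫ l ◁ Z₀ ⊗≫ η' ▷ y ⊗≫ 𝟙 y) = Z₀ := by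
  -- Insert the right zigzag, which is a coherence; its unit cancels against `η'` and the counit
  -- remains.
  have hη : r ◁ η' = 𝟙 _ ⊗≫ adj.counit ▷ r ⊗≫ 𝟙 _ := by
    calc
      _ = r ◁ η' ⊗≫ rightZigzag adj.unit adj.counit ⊗≫ 𝟙 (r ≫ 𝟙 X) := by
        rw [adj.right_triangle]; bicategory
      _ = r ◁ (η' ≫ adj.unit) ⊗≫ adj.counit ▷ r ⊗≫ 𝟙 (r ≫ 𝟙 X) := by bicategory
      _ = _ := by rw [h]; bicategory
  calc
    _ = 𝟙 _ ⊗≫ r ◁ (𝟙 x ⊗≫ adj.unit ▷ x ⊗≫ l ◁ Z₀) ⊗≫ (r ◁ η') ▷ y ⊗≫ 𝟙 _ := by bicategory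
    _ = r ◁ (𝟙 x ⊗≫ adj.unit ▷ x ⊗≫ l ◁ Z₀) ⊗≫ adj.counit ▷ (r ≫ y) ⊗≫ 𝟙 _ := by
      rw [hη]; bicategory
    _ = Z₀ := by
      refine Eq.trans ?_ (counit_unit_straighten adj Z₀)
      bicategory

/-- The crossing of two left boundaries. -/
abbrev crossLeftPasting {U A B D UB AU UU : C} {lA : U ⟶ A} {lB : U ⟶ B}
    {lamB : UB ⟶ B} {lamB' : B ⟶ UB} {lamU : UU ⟶ U} {lamU' : U ⟶ UU} {rhoA : AU ⟶ A}
    {rhoA' : A ⟶ AU} {rhoU : UU ⟶ U} {lAB : UB ⟶ D} {lAU : UU ⟶ AU}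
    {AlB : AU ⟶ D} {UlB : UU ⟶ UB}
    (u : lamU ≅ rhoU) (nl : UlB ≫ lamB ≅ lamU ≫ lB)
    (nr : lAU ≫ rhoA ≅ rhoU ≫ lA) (i : lAU ≫ AlB ≅ UlB ≫ lAB)
    (unitU : 𝟙 U ⟶ lamU' ≫ lamU) (unitU' : lamU' ≫ lamU ⟶ 𝟙 U) (counitB' : 𝟙 UB ⟶ lamB ≫ lamB')
    (counitA : rhoA ≫ rhoA' ⟶ 𝟙 AU) : lA ≫ rhoA' ≫ AlB ⟶ lB ≫ lamB' ≫ lAB :=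
  𝟙 _ ⊗≫ unitU ▷ (lA ≫ rhoA' ≫ AlB) ⊗≫ lamU' ◁ u.hom ▷ (lA ≫ rhoA' ≫ AlB) ⊗≫
    lamU' ◁ nr.inv ▷ (rhoA' ≫ AlB) ⊗≫ (lamU' ≫ lAU) ◁ counitA ▷ AlB ⊗≫ lamU' ◁ i.hom ⊗≫
    (lamU' ≫ UlB) ◁ counitB' ▷ lAB ⊗≫ lamU' ◁ nl.hom ▷ (lamB' ≫ lAB) ⊗≫
    unitU' ▷ (lB ≫ lamB' ≫ lAB) ⊗≫ 𝟙 _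

/-- The wire of A meets both ends of the arc of B. Crossing one end and gluing in the layer next to
A amounts to crossing the other end first and gluing B before the wire of A begins. -/
theorem cross_slide {U A B D UB AU UU : C} {lA : U ⟶ A} {rB : B ⟶ U} {lB : U ⟶ B}
    {lamB : UB ⟶ B} {lamB' : B ⟶ UB} {lamU : UU ⟶ U} {lamU' : U ⟶ UU} {rhoA : AU ⟶ A}
    {rhoA' : A ⟶ AU} {rhoU : UU ⟶ U} {lAB : UB ⟶ D} {lAU : UU ⟶ AU}
    {ArB : D ⟶ AU} {UrB : UB ⟶ UU} {AlB : AU ⟶ D} {UlB : UU ⟶ UB}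
    (u : lamU ≅ rhoU) (nl : UrB ≫ lamU ≅ lamB ≫ rB) (nl' : UlB ≫ lamB ≅ lamU ≫ lB)
    (nr : lAU ≫ rhoA ≅ rhoU ≫ lA) (i : lAB ≫ ArB ≅ UrB ≫ lAU) (i' : lAU ≫ AlB ≅ UlB ≫ lAB)
    (adjB : lamB' ⊣ lamB) (adjU : lamU' ⊣ lamU) (counitA : rhoA ≫ rhoA' ⟶ 𝟙 AU)
    {unitU' : lamU' ≫ lamU ⟶ 𝟙 U} {counitB' : 𝟙 UB ⟶ lamB ≫ lamB'}
    (gB : rB ≫ lB ⟶ 𝟙 B) (gAB : ArB ≫ AlB ⟶ 𝟙 D) (gUB : UrB ≫ UlB ⟶ 𝟙 UB)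
    (hU : unitU' ≫ adjU.unit = 𝟙 _)
    (hB : counitB' ≫ adjB.counit = 𝟙 _)
    (hl : UrB ◁ nl'.inv ⊗≫ gUB ▷ lamB ⊗≫ 𝟙 lamB = 𝟙 _ ⊗≫ nl.hom ▷ lB ⊗≫ lamB ◁ gB ⊗≫ 𝟙 _)
    (hi : UrB ◁ i'.hom ⊗≫ gUB ▷ lAB ⊗≫ 𝟙 lAB = 𝟙 _ ⊗≫ i.inv ▷ AlB ⊗≫ lAB ◁ gAB ⊗≫ 𝟙 _) :
    (𝟙 (rB ≫ lA) ⊗≫ adjB.unit ▷ (rB ≫ lA) ⊗≫ lamB' ◁ (nl.inv ▷ lA) ⊗≫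
        (lamB' ≫ UrB) ◁ (u.hom ▷ lA) ⊗≫ (lamB' ≫ UrB) ◁ nr.inv ⊗≫ lamB' ◁ i.inv ▷ rhoA ⊗≫
          𝟙 ((lamB' ≫ lAB) ≫ ArB ≫ rhoA)) ▷ (rhoA' ≫ AlB) ⊗≫
      (lamB' ≫ lAB) ◁ (𝟙 ((ArB ≫ rhoA) ≫ rhoA' ≫ AlB) ⊗≫ ArB ◁ counitA ▷ AlB ⊗≫ gAB) ⊗≫ 𝟙 (lamB' ≫ lAB) =
    𝟙 _ ⊗≫ rB ◁ crossLeftPasting u nl' nr i' adjU.unit unitU' counitB' counitA ⊗≫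
      gB ▷ (lamB' ≫ lAB) ⊗≫ 𝟙 _ := by
  set Ψ : lamU ≫ lA ≫ rhoA' ≫ AlB ⟶ UlB ≫ lAB := u.hom ▷ (lA ≫ rhoA' ≫ AlB) ⊗≫
    nr.inv ▷ (rhoA' ≫ AlB) ⊗≫ lAU ◁ counitA ▷ AlB ⊗≫ i'.hom with hΨ
  -- The crossing of left boundaries without its outer pair of unitors. It is what `lamU ◁ Y`
  -- reduces to, since the unitor is an equivalence.
  set Z₀ : lamU ≫ lA ≫ rhoA' ≫ AlB ⟶ lamU ≫ lB ≫ lamB' ≫ lAB :=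
    Ψ ⊗≫ UlB ◁ counitB' ▷ lAB ⊗≫ nl'.hom ▷ (lamB' ≫ lAB) ⊗≫ 𝟙 _ with hZ₀
  have hZ : Z₀ ⊗≫ nl'.inv ▷ (lamB' ≫ lAB) ⊗≫ UlB ◁ adjB.counit ▷ lAB ⊗≫ 𝟙 _ = Ψ := by
    calc
      _ = Ψ ⊗≫ UlB ◁ counitB' ▷ lAB ⊗≫ (nl'.hom ≫ nl'.inv) ▷ (lamB' ≫ lAB) ⊗≫
          UlB ◁ adjB.counit ▷ lAB ⊗≫ 𝟙 _ := by rw [hZ₀]; bicategory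
      _ = Ψ ⊗≫ UlB ◁ (counitB' ≫ adjB.counit) ▷ lAB ⊗≫ 𝟙 _ := by
        rw [Iso.hom_inv_id]; bicategory
      _ = Ψ := by rw [hB]; bicategory
  have hY : crossLeftPasting u nl' nr i' adjU.unit unitU' counitB' counitA =
      𝟙 _ ⊗≫ adjU.unit ▷ (lA ≫ rhoA' ≫ AlB) ⊗≫ lamU' ◁ Z₀ ⊗≫ unitU' ▷ (lB ≫ lamB' ≫ lAB) ⊗≫ 𝟙 _ := by
    rw [hZ₀, hΨ]; bicategory
  set Y := crossLeftPasting u nl' nr i' adjU.unit unitU' counitB' counitA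
  have hYZ : lamU ◁ Y = Z₀ := by
    rw [hY]
    refine Eq.trans ?_ (conj_equivalence adjU hU Z₀)
    bicategory
  calc
    _ = 𝟙 _ ⊗≫ adjB.unit ▷ (rB ≫ lA ≫ rhoA' ≫ AlB) ⊗≫ lamB' ◁ nl.inv ▷ (lA ≫ rhoA' ≫ AlB) ⊗≫
        (lamB' ≫ UrB) ◁ (u.hom ▷ (lA ≫ rhoA' ≫ AlB)) ⊗≫
        (lamB' ≫ UrB) ◁ nr.inv ▷ (rhoA' ≫ AlB) ⊗≫
        lamB' ◁ (i.inv ▷ (rhoA ≫ rhoA') ≫ (lAB ≫ ArB) ◁ counitA) ▷ AlB ⊗≫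
        (lamB' ≫ lAB) ◁ gAB ⊗≫ 𝟙 (lamB' ≫ lAB) := by bicategory
    _ = 𝟙 _ ⊗≫ adjB.unit ▷ (rB ≫ lA ≫ rhoA' ≫ AlB) ⊗≫ lamB' ◁ nl.inv ▷ (lA ≫ rhoA' ≫ AlB) ⊗≫
        (lamB' ≫ UrB) ◁ (u.hom ▷ (lA ≫ rhoA' ≫ AlB) ⊗≫
          nr.inv ▷ (rhoA' ≫ AlB) ⊗≫ lAU ◁ counitA ▷ AlB) ⊗≫
        lamB' ◁ (𝟙 (UrB ≫ lAU ≫ AlB) ⊗≫ i.inv ▷ AlB ⊗≫ lAB ◁ gAB ⊗≫ 𝟙 lAB) ⊗≫ 𝟙 (lamB' ≫ lAB) := by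
      rw [← whisker_exchange]; bicategory
    _ = 𝟙 _ ⊗≫ adjB.unit ▷ (rB ≫ lA ≫ rhoA' ≫ AlB) ⊗≫ lamB' ◁ nl.inv ▷ (lA ≫ rhoA' ≫ AlB) ⊗≫
        (lamB' ≫ UrB) ◁ Ψ ⊗≫ lamB' ◁ gUB ▷ lAB ⊗≫ 𝟙 (lamB' ≫ lAB) := by
      rw [← hi, hΨ]; bicategory
    _ = 𝟙 _ ⊗≫ adjB.unit ▷ (rB ≫ lA ≫ rhoA' ≫ AlB) ⊗≫
        lamB' ◁ (nl.inv ▷ (lA ≫ rhoA' ≫ AlB) ≫ (UrB ≫ lamU) ◁ Y) ⊗≫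
        (lamB' ≫ UrB) ◁ nl'.inv ▷ (lamB' ≫ lAB) ⊗≫
        lamB' ◁ ((UrB ≫ UlB) ◁ adjB.counit ≫ gUB ▷ 𝟙 _) ▷ lAB ⊗≫ 𝟙 (lamB' ≫ lAB) := by
      rw [← hZ, ← hYZ]; bicategory
    _ = 𝟙 _ ⊗≫ (adjB.unit ▷ (rB ≫ lA ≫ rhoA' ≫ AlB) ≫ (lamB' ≫ lamB) ◁ rB ◁ Y) ⊗≫
        lamB' ◁ nl.inv ▷ (lB ≫ lamB' ≫ lAB) ⊗≫
        lamB' ◁ (UrB ◁ nl'.inv ⊗≫ gUB ▷ lamB ⊗≫ 𝟙 lamB) ▷ (lamB' ≫ lAB) ⊗≫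
        lamB' ◁ adjB.counit ▷ lAB ⊗≫ 𝟙 (lamB' ≫ lAB) := by
      rw [← whisker_exchange, whisker_exchange gUB]; bicategory
    _ = 𝟙 _ ⊗≫ rB ◁ Y ⊗≫ adjB.unit ▷ (rB ≫ lB ≫ lamB' ≫ lAB) ⊗≫
        lamB' ◁ (nl.inv ≫ nl.hom) ▷ (lB ≫ lamB' ≫ lAB) ⊗≫
        (lamB' ≫ lamB) ◁ gB ▷ (lamB' ≫ lAB) ⊗≫
        lamB' ◁ adjB.counit ▷ lAB ⊗≫ 𝟙 (lamB' ≫ lAB) := by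
      rw [← whisker_exchange, hl]; bicategory
    _ = 𝟙 _ ⊗≫ rB ◁ Y ⊗≫ (adjB.unit ▷ (rB ≫ lB) ≫ (lamB' ≫ lamB) ◁ gB) ▷ (lamB' ≫ lAB) ⊗≫
        lamB' ◁ adjB.counit ▷ lAB ⊗≫ 𝟙 (lamB' ≫ lAB) := by
      rw [Iso.inv_hom_id]; bicategory
    _ = 𝟙 _ ⊗≫ rB ◁ Y ⊗≫ gB ▷ (lamB' ≫ lAB) ⊗≫
        leftZigzag adjB.unit adjB.counit ▷ lAB ⊗≫ 𝟙 (lamB' ≫ lAB) := by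
      rw [← whisker_exchange]; bicategory
    _ = _ := by
      rw [adjB.left_triangle]; bicategory

/-- Gluing the overlap after a crossing: cross the other ends instead, and glue one after the
other. -/
theorem cross_overlap_glue {U A B D V : C} {rA : A ⟶ U} {lA : U ⟶ A} {rB : B ⟶ U} {lB : U ⟶ B}
    {F : B ⟶ D} {F' : D ⟶ B} {s : D ⟶ V} {t : V ⟶ A} {E : A ⟶ D}
    (χ : rB ≫ lA ⟶ F ≫ s ≫ t) (ψ : s ≫ t ≫ rA ⟶ F' ≫ rB) (gA : rA ≫ lA ⟶ 𝟙 A)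
    (gB : rB ≫ lB ⟶ 𝟙 B) (gD : (s ≫ t ≫ rA) ≫ lB ≫ F ⟶ 𝟙 D) (cF : F' ≫ F ⟶ 𝟙 D)
    (cE : (s ≫ t) ≫ E ⟶ 𝟙 D) (e : lB ≫ F ≅ lA ≫ E)
    (hD : gD = 𝟙 _ ⊗≫ ψ ▷ (lB ≫ F) ⊗≫ F' ◁ gB ▷ F ⊗≫ cF)
    (h₁ : ψ ▷ lA ⊗≫ F' ◁ χ ⊗≫ cF ▷ (s ≫ t) ⊗≫ 𝟙 (s ≫ t) = 𝟙 _ ⊗≫ (s ≫ t) ◁ gA ⊗≫ 𝟙 _)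
    (h₂ : χ ▷ E ⊗≫ F ◁ cE ⊗≫ 𝟙 F = 𝟙 _ ⊗≫ rB ◁ e.inv ⊗≫ gB ▷ F ⊗≫ 𝟙 _) :
    χ ▷ (rA ≫ lB ≫ F) ⊗≫ F ◁ gD ⊗≫ 𝟙 F =
      𝟙 _ ⊗≫ (rB ≫ lA ≫ rA) ◁ e.hom ⊗≫ (rB ≫ lA) ◁ gA ▷ E ⊗≫ rB ◁ e.inv ⊗≫ gB ▷ F ⊗≫ 𝟙 _ := by
  -- The overlap, glued B first by `hD`, can instead be glued A first: `h₂` replaces the arc of B by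
  -- χ and `cE`, and then `h₁` pulls the arc of A free.
  have h₃ : (s ≫ t ≫ rA) ◁ e.inv ≫ gD = 𝟙 _ ⊗≫ (s ≫ t) ◁ gA ▷ E ⊗≫ cE := by
    calc
      _ = 𝟙 _ ⊗≫ ((s ≫ t ≫ rA) ◁ e.inv ≫ ψ ▷ (lB ≫ F)) ⊗≫ F' ◁ gB ▷ F ⊗≫ cF := by
        rw [hD]; bicategory
      _ = 𝟙 _ ⊗≫ ψ ▷ (lA ≫ E) ⊗≫ F' ◁ (𝟙 ((rB ≫ lA) ≫ E) ⊗≫ rB ◁ e.inv ⊗≫ gB ▷ F ⊗≫ 𝟙 F) ⊗≫ cF := by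
        rw [whisker_exchange]; bicategory
      _ = 𝟙 _ ⊗≫ ψ ▷ (lA ≫ E) ⊗≫ F' ◁ χ ▷ E ⊗≫ ((F' ≫ F) ◁ cE ≫ cF ▷ 𝟙 _) ⊗≫ 𝟙 _ := by
        rw [← h₂]; bicategory
      _ = 𝟙 _ ⊗≫ (ψ ▷ lA ⊗≫ F' ◁ χ ⊗≫ cF ▷ (s ≫ t) ⊗≫ 𝟙 (s ≫ t)) ▷ E ⊗≫ cE := by
        rw [whisker_exchange]; bicategory
      _ = _ := by
        rw [h₁]; bicategory
  have hD' : gD = (s ≫ t ≫ rA) ◁ e.hom ⊗≫ (s ≫ t) ◁ gA ▷ E ⊗≫ cE := by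
    calc
      _ = (s ≫ t ≫ rA) ◁ e.hom ≫ (s ≫ t ≫ rA) ◁ e.inv ≫ gD := by simp
      _ = _ := by rw [h₃]; bicategory
  calc
    _ = 𝟙 _ ⊗≫ (χ ▷ (rA ≫ lB ≫ F) ≫ (F ≫ s ≫ t) ◁ (rA ◁ e.hom ⊗≫ gA ▷ E)) ⊗≫ F ◁ cE ⊗≫ 𝟙 F := by
      rw [hD']; bicategory
    _ = 𝟙 _ ⊗≫ (rB ≫ lA) ◁ (rA ◁ e.hom ⊗≫ gA ▷ E) ⊗≫ (χ ▷ E ⊗≫ F ◁ cE ⊗≫ 𝟙 F) := by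
      rw [← whisker_exchange]; bicategory
    _ = _ := by
      rw [h₂]; bicategory

end Pasting

/-! ### Splitting the partial transpose of λ into rotated copies of δ. -/

section Communication

variable {C : Type u} [Bicategory.{w, v} C] [DaggerBicategory C] [TensorBicategory C]
  {A B : C} (a : Boundary A) (b : Boundary B)

/-- Separation of A in the cup and gluing of B in the cap already form δ'; creation and destruction
are what is left. -/
theorem halfTurnClockwise_eq (δ : a.strip ⟶ b.strip) :
    halfTurnClockwise a b δ =
      𝟙 _ ⊗≫ a.create ▷ b.strip ⊗≫ a.left ◁ partialTranspose a b δ ▷ b.right ⊗≫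
        a.strip ◁ b.destroy ⊗≫ 𝟙 _ := by
  rw [halfTurnClockwise_eq_mate, mateEquiv_symm_apply']
  simp only [daggerAdjunction]
  bicategory

/-- Bend the left boundary of B and straighten it again by a zigzag of separation and destruction.
-/
theorem whiskerRight_glue_eq_partialTranspose (κ : b.strip ⟶ a.strip) :
    κ ▷ a.left ⊗≫ a.left ◁ a.glue ⊗≫ 𝟙 _ =
      𝟙 _ ⊗≫ b.left ◁ partialTranspose b a κ ⊗≫ b.destroy ▷ a.left ⊗≫ 𝟙 a.left := by
  have h : b.left ◁ b.separate ⊗≫ b.destroy ▷ b.left = (ρ_ b.left).hom ≫ (λ_ b.left).inv :=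
    (daggerAdjunction b.adj).right_triangle
  symm
  calc
    _ = 𝟙 _ ⊗≫ b.left ◁ b.separate ▷ (b.right ≫ a.left) ⊗≫
          ((b.left ≫ b.right) ◁ (κ ▷ a.left ⊗≫ a.left ◁ a.glue ⊗≫ 𝟙 a.left) ≫
            b.destroy ▷ a.left) ⊗≫ 𝟙 a.left := by
      rw [partialTranspose]; bicategory
    _ = 𝟙 _ ⊗≫ (b.left ◁ b.separate ⊗≫ b.destroy ▷ b.left) ▷ (b.right ≫ a.left) ⊗≫
          (κ ▷ a.left ⊗≫ a.left ◁ a.glue ⊗≫ 𝟙 a.left) := by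
      rw [whisker_exchange]; bicategory
    _ = _ := by
      rw [h]; bicategory

/-- The partial transpose of the communication structure is a composite of rotated copies of `δ`
and of crossings. -/
theorem commPartialTranspose_eq {D V : C} (δ : a.strip ⟶ b.strip)
    {F : B ⟶ D} {s : D ⟶ V} {t : V ⟶ A} {E : A ⟶ D}
    (χ : b.right ≫ a.left ⟶ F ≫ s ≫ t) (gD : (s ≫ t ≫ a.right) ≫ b.left ≫ F ⟶ 𝟙 D)
    (e : b.left ≫ F ≅ a.left ≫ E)
    (h : χ ▷ (a.right ≫ b.left ≫ F) ⊗≫ F ◁ gD ⊗≫ 𝟙 F =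
      𝟙 _ ⊗≫ (b.right ≫ a.left ≫ a.right) ◁ e.hom ⊗≫ (b.right ≫ a.left) ◁ a.glue ▷ E ⊗≫
        b.right ◁ e.inv ⊗≫ b.glue ▷ F ⊗≫ 𝟙 _) :
    𝟙 (b.strip ≫ b.left ≫ F) ⊗≫ a.cup ▷ (b.strip ≫ b.left ≫ F) ⊗≫ a.strip ◁ (𝟙 (a.strip ≫ b.strip) ⊗≫
      a.left ◁ partialTranspose a b δ ▷ b.right ⊗≫ δ ▷ b.strip ≫ b.strip ◁ dag δ ⊗≫
        b.left ◁ χ ▷ a.right ⊗≫ 𝟙 ((b.left ≫ F) ≫ (s ≫ t ≫ a.right))) ▷ (b.left ≫ F) ⊗≫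
      (a.strip ≫ b.left ≫ F) ◁ gD ⊗≫ 𝟙 (a.strip ≫ b.left ≫ F) =
    𝟙 _ ⊗≫ b.strip ◁ e.hom ⊗≫ b.left ◁ partialTranspose b a (dag δ) ▷ E ⊗≫
      halfTurnClockwise a b δ ▷ (a.left ≫ E) ⊗≫ a.strip ◁ e.inv ⊗≫
        a.left ◁ partialTranspose a b δ ▷ F ⊗≫ 𝟙 (a.strip ≫ b.left ≫ F) := by
  calc
    _ = 𝟙 _ ⊗≫ a.cup ▷ (b.strip ≫ b.left ≫ F) ⊗≫
        (a.strip ≫ a.left) ◁ partialTranspose a b δ ▷ (b.right ≫ b.left ≫ F) ⊗≫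
        a.strip ◁ (δ ▷ b.strip ≫ b.strip ◁ dag δ) ▷ (b.left ≫ F) ⊗≫
        (a.strip ≫ b.left) ◁ (χ ▷ (a.right ≫ b.left ≫ F) ⊗≫ F ◁ gD ⊗≫ 𝟙 F) ⊗≫
        𝟙 (a.strip ≫ b.left ≫ F) := by bicategory
    _ = 𝟙 _ ⊗≫ ((𝟙 b.strip ⊗≫ a.cup ▷ b.strip ⊗≫
          (a.strip ≫ a.left) ◁ partialTranspose a b δ ▷ b.right ⊗≫
          a.strip ◁ (δ ▷ b.strip ≫ b.strip ◁ dag δ)) ▷ (b.left ≫ F) ≫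
            (a.strip ≫ b.strip ≫ a.strip) ◁ e.hom) ⊗≫
        (a.strip ≫ b.strip ≫ a.left) ◁ a.glue ▷ E ⊗≫ (a.strip ≫ b.strip) ◁ e.inv ⊗≫
        (a.strip ≫ b.left) ◁ b.glue ▷ F ⊗≫ 𝟙 (a.strip ≫ b.left ≫ F) := by
      rw [h]; bicategory
    _ = 𝟙 _ ⊗≫ b.strip ◁ e.hom ⊗≫ a.cup ▷ (b.strip ≫ a.left ≫ E) ⊗≫
          (a.strip ≫ a.left) ◁ partialTranspose a b δ ▷ (b.right ≫ a.left ≫ E) ⊗≫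
          a.strip ◁ δ ▷ (b.strip ≫ a.left ≫ E) ⊗≫
        (a.strip ≫ b.strip) ◁ (dag δ ▷ a.left ⊗≫ a.left ◁ a.glue ⊗≫ 𝟙 a.left) ▷ E ⊗≫
        (a.strip ≫ b.strip) ◁ e.inv ⊗≫
        (a.strip ≫ b.left) ◁ b.glue ▷ F ⊗≫ 𝟙 (a.strip ≫ b.left ≫ F) := by
      rw [← whisker_exchange]; bicategory
    -- The third copy `dag δ` absorbs the gluing of A and releases a destruction of B, which will
    -- close the half turn.
    _ = 𝟙 _ ⊗≫ b.strip ◁ e.hom ⊗≫ a.cup ▷ (b.strip ≫ a.left ≫ E) ⊗≫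
          (a.strip ≫ a.left) ◁ partialTranspose a b δ ▷ (b.right ≫ a.left ≫ E) ⊗≫
        a.strip ◁ (δ ▷ (b.strip ≫ a.left ≫ E) ≫ b.strip ◁
          (𝟙 (b.strip ≫ a.left ≫ E) ⊗≫ b.left ◁ partialTranspose b a (dag δ) ▷ E ⊗≫ b.destroy ▷ (a.left ≫ E) ⊗≫
            e.inv)) ⊗≫
        (a.strip ≫ b.left) ◁ b.glue ▷ F ⊗≫ 𝟙 (a.strip ≫ b.left ≫ F) := by
      rw [whiskerRight_glue_eq_partialTranspose]; bicategory
    _ = 𝟙 _ ⊗≫ b.strip ◁ e.hom ⊗≫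
          ((𝟙 b.left ⊗≫ a.cup ▷ b.left ⊗≫ (a.strip ≫ a.left) ◁ partialTranspose a b δ ⊗≫
              𝟙 (a.strip ≫ a.left ≫ a.right ≫ b.left)) ▷
              (b.right ≫ a.left) ≫ (a.strip ≫ a.left ≫ a.right ≫ b.left) ◁
            partialTranspose b a (dag δ)) ▷ E ⊗≫
        (a.strip ≫ a.strip) ◁ b.destroy ▷ (a.left ≫ E) ⊗≫ (a.strip ≫ a.strip) ◁ e.inv ⊗≫
        a.strip ◁ δ ▷ (b.left ≫ F) ⊗≫
        (a.strip ≫ b.left) ◁ b.glue ▷ F ⊗≫ 𝟙 (a.strip ≫ b.left ≫ F) := by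
      rw [← whisker_exchange δ]; bicategory
    _ = 𝟙 _ ⊗≫ b.strip ◁ e.hom ⊗≫ b.left ◁ partialTranspose b a (dag δ) ▷ E ⊗≫
        a.create ▷ (b.strip ≫ a.left ≫ E) ⊗≫
        a.left ◁ (a.separate ▷ (a.right ≫ b.strip ≫ a.left ≫ E) ≫ (a.right ≫ a.left) ◁
          (𝟙 (a.right ≫ b.strip ≫ a.left ≫ E) ⊗≫ partialTranspose a b δ ▷ (b.right ≫ a.left ≫ E) ⊗≫
            a.right ◁ b.destroy ▷ (a.left ≫ E) ⊗≫ a.right ◁ e.inv)) ⊗≫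
        a.strip ◁ δ ▷ (b.left ≫ F) ⊗≫
        (a.strip ≫ b.left) ◁ b.glue ▷ F ⊗≫ 𝟙 (a.strip ≫ b.left ≫ F) := by
      rw [← whisker_exchange]
      simp only [Boundary.cup]
      bicategory
    -- The separation of A slides below the half turn and joins δ and the gluing of B, forming δ'.
    _ = 𝟙 _ ⊗≫ b.strip ◁ e.hom ⊗≫ b.left ◁ partialTranspose b a (dag δ) ▷ E ⊗≫
        (𝟙 b.strip ⊗≫ a.create ▷ b.strip ⊗≫ a.left ◁ partialTranspose a b δ ▷ b.right ⊗≫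
          a.strip ◁ b.destroy ⊗≫ 𝟙 a.strip) ▷ (a.left ≫ E) ⊗≫ a.strip ◁ e.inv ⊗≫
        a.left ◁ (𝟙 (a.right ≫ b.left) ⊗≫ a.separate ▷ (a.right ≫ b.left) ⊗≫
          a.right ◁ δ ▷ b.left ⊗≫ (a.right ≫ b.left) ◁ b.glue ⊗≫ 𝟙 (a.right ≫ b.left)) ▷ F ⊗≫
        𝟙 (a.strip ≫ b.left ≫ F) := by
      rw [← whisker_exchange]; bicategory
    _ = _ := by
      rw [halfTurnClockwise_eq]; rfl

end Communication

/-! ### Crossings and gluing of the overlap, and unitarity of both pastings. -/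

section Overlap

variable {C : Type u} [Bicategory.{w, v} C] [DaggerBicategory C] [TensorBicategory C]

theorem isUnitary_map₂Iso {X Y : C × C} {f g : X ⟶ Y} {e : f ≅ g} (h₁ : IsUnitary e.hom.1)
    (h₂ : IsUnitary e.hom.2) : IsUnitary (tensor.map₂ e.hom) := by
  rw [IsUnitary, dag_map₂, ← PrelaxFunctor.map₂_comp, ← PrelaxFunctor.map₂_comp]
  have h : e.hom ≫ (dag e.hom.1, dag e.hom.2) = 𝟙 f := Prod.ext h₁.1 h₂.1
  have h' : (dag e.hom.1, dag e.hom.2) ≫ e.hom = 𝟙 g := Prod.ext h₁.2 h₂.2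
  exact ⟨(congrArg tensor.map₂ h).trans (tensor.map₂_id _),
    (congrArg tensor.map₂ h').trans (tensor.map₂_id _)⟩

theorem isUnitary_interchange {X X' Y Y' : C} (f : X ⟶ X') (g : Y ⟶ Y') :
    IsUnitary (interchange f g).hom := by
  refine (mapComp_unitary _ _).inv.comp (.comp (isUnitary_map₂Iso ?_ ?_) (mapComp_unitary _ _))
  · exact .comp (.rightUnitor f) (IsUnitary.leftUnitor f).inv
  · exact .comp (.leftUnitor g) (IsUnitary.rightUnitor g).inv

theorem isUnitary_leftUnitNat {X Y : C} (f : X ⟶ Y) : IsUnitary (leftUnitNat f).hom :=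
  leftUnitor_naturality_unitary f

theorem isUnitary_rightUnitNat {X Y : C} (f : X ⟶ Y) : IsUnitary (rightUnitNat f).hom :=
  rightUnitor_naturality_unitary f

theorem isUnitary_unitIso : IsUnitary (unitIso (C := C)).hom := unitorIso_unitary

/-- The adjoint equivalence given by the right unitor at `X`. -/
def rightUnitAdj (X : C) : rightUnitorInv X ⊣ rightUnit X := rightUnitorAdj X

variable {A B : C} (a : Boundary A) (b : Boundary B)

theorem isUnitary_crossMiddle : IsUnitary (crossMiddle a b) := by
  unfold crossMiddle
  refine (IsUnitary.id _).bicategoricalComp (.bicategoricalComp (.whiskerRight ?_ _)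
    (.bicategoricalComp (.whiskerLeft _ (.whiskerRight ?_ _)) (.bicategoricalComp
    (.whiskerLeft _ (.whiskerRight ?_ _)) (.bicategoricalComp (.whiskerLeft _ ?_)
    (.bicategoricalComp (.whiskerLeft _ (.whiskerRight ?_ _)) (.id _))))))
  · exact leftUnitorAdj_unit_unitary B
  · exact (isUnitary_leftUnitNat _).inv
  · exact isUnitary_unitIso
  · exact (isUnitary_rightUnitNat _).inv
  · exact (isUnitary_interchange _ _).inv

/-- The left boundaries of `A` and `B` cross. -/
def crossLeft : a.left ≫ rightUnitorInv A ≫ secondLayer A b.left ⟶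
    b.left ≫ leftUnitInv B ≫ firstLayer a.left B :=
  crossLeftPasting unitIso (leftUnitNat b.left) (rightUnitNat a.left) (interchange a.left b.left)
    (leftUnitAdj unit).unit (dag (leftUnitAdj unit).unit) (dag (leftUnitAdj B).counit)
    (rightUnitAdj A).counit

theorem isUnitary_crossLeft : IsUnitary (crossLeft a b) := by
  have hu : IsUnitary (leftUnitAdj (unit : C)).unit := leftUnitorAdj_unit_unitary unit
  unfold crossLeft crossLeftPasting
  refine (IsUnitary.id _).bicategoricalComp (.bicategoricalComp (.whiskerRight hu _)
    (.bicategoricalComp (.whiskerLeft _ (.whiskerRight isUnitary_unitIso _)) (.bicategoricalComp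
    (.whiskerLeft _ (.whiskerRight (isUnitary_rightUnitNat _).inv _))
    (.bicategoricalComp (.whiskerLeft _ (.whiskerRight ?_ _))
    (.bicategoricalComp (.whiskerLeft _ (isUnitary_interchange _ _))
    (.bicategoricalComp (.whiskerLeft _ (.whiskerRight ?_ _))
    (.bicategoricalComp (.whiskerLeft _ (.whiskerRight (isUnitary_leftUnitNat _) _))
    (.bicategoricalComp (.whiskerRight hu.dag _) (.id _)))))))))
  · exact rightUnitorAdj_counit_unitary A
  · exact (leftUnitorAdj_counit_unitary B).dag

/-- The crossing of the left boundaries as an isomorphism. -/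
def crossLeftIso : b.left ≫ leftUnitInv B ≫ firstLayer a.left B ≅
    a.left ≫ rightUnitorInv A ≫ secondLayer A b.left where
  hom := dag (crossLeft a b)
  inv := crossLeft a b
  hom_inv_id := (isUnitary_crossLeft a b).2
  inv_hom_id := (isUnitary_crossLeft a b).1

/-- Gluing of the overlap. -/
def overlapGlue : (secondLayer A b.right ≫ rightUnit A ≫ a.right) ≫
    b.left ≫ leftUnitInv B ≫ firstLayer a.left B ⟶ 𝟙 (overlay A B) :=
  (a.overlap b).glue

/-- The inverse crossing of the right boundaries. -/
def crossRightInv : secondLayer A b.right ≫ rightUnit A ≫ a.right ⟶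
    (firstLayer a.right B ≫ leftUnit B) ≫ b.right :=
  (crossRight a b).inv ≫ (α_ _ _ _).inv

theorem crossRightInv_eq : crossRightInv a b =
    𝟙 (secondLayer A b.right ≫ rightUnit A ≫ a.right) ⊗≫
      secondLayer A b.right ◁ (rightUnitNat a.right).inv ⊗≫
      (secondLayer A b.right ≫ firstLayer a.right unit) ◁ unitIso.inv ⊗≫
      (interchange a.right b.right).inv ▷ leftUnit unit ⊗≫
      firstLayer a.right B ◁ (leftUnitNat b.right).hom ⊗≫
        𝟙 ((firstLayer a.right B ≫ leftUnit B) ≫ b.right) := by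
  have h : crossRightInv a b = (((((secondLayer A b.right ◁ (rightUnitNat a.right).inv ≫
      (α_ _ _ _).inv) ≫ (secondLayer A b.right ≫ firstLayer a.right unit) ◁ unitIso.inv) ≫
      (interchange a.right b.right).inv ▷ leftUnit unit) ≫
      (α_ (firstLayer a.right B) (secondLayer unit b.right) (leftUnit unit)).hom) ≫
      firstLayer a.right B ◁ (leftUnitNat b.right).hom) ≫
      (α_ (firstLayer a.right B) (leftUnit B) b.right).inv := rfl
  rw [h]
  bicategory

/-- The counit of the composite adjunction is nested: uncross the right boundaries, then glue B,
cancel the unitor, and glue A in its layer. -/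
theorem overlapGlue_eq : overlapGlue a b = 𝟙 _ ⊗≫
    crossRightInv a b ▷ (b.left ≫ leftUnitInv B ≫ firstLayer a.left B) ⊗≫
      (firstLayer a.right B ≫ leftUnit B) ◁ b.glue ▷ (leftUnitInv B ≫ firstLayer a.left B) ⊗≫
      (𝟙 ((firstLayer a.right B ≫ leftUnit B) ≫ leftUnitInv B ≫ firstLayer a.left B) ⊗≫
        firstLayer a.right B ◁ (leftUnitAdj B).counit ▷ firstLayer a.left B ⊗≫
          (firstLayerAdj a.adj B).counit) := by
  have h : overlapGlue a b = crossRightInv a b ▷ (b.left ≫ leftUnitInv B ≫ firstLayer a.left B) ≫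
      (b.adj.comp ((leftUnitAdj B).comp (firstLayerAdj a.adj B))).counit := rfl
  rw [h]
  simp only [Bicategory.Adjunction.comp, Bicategory.Adjunction.compCounit]
  bicategory

/-- The instance of `cross_overlap_glue` for the tensor product: `cross_glue` pulls the arc of A
across the right boundary of B, and `cross_slide` moves the wire of A across the arc of B. -/
theorem crossMiddle_glue :
    crossMiddle a b ▷ (a.right ≫ b.left ≫ leftUnitInv B ≫ firstLayer a.left B) ⊗≫
      (leftUnitInv B ≫ firstLayer a.left B) ◁ overlapGlue a b ⊗≫
        𝟙 (leftUnitInv B ≫ firstLayer a.left B) =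
      𝟙 _ ⊗≫ (b.right ≫ a.left ≫ a.right) ◁ (crossLeftIso a b).hom ⊗≫
        (b.right ≫ a.left) ◁ a.glue ▷ (rightUnitorInv A ≫ secondLayer A b.left) ⊗≫
          b.right ◁ (crossLeftIso a b).inv ⊗≫
            b.glue ▷ (leftUnitInv B ≫ firstLayer a.left B) ⊗≫ 𝟙 _ := by
  refine Eq.trans ?_ (Eq.trans (cross_overlap_glue (crossMiddle a b) (crossRightInv a b) a.glue b.glue (overlapGlue a b)
    (𝟙 ((firstLayer a.right B ≫ leftUnit B) ≫ leftUnitInv B ≫ firstLayer a.left B) ⊗≫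
      firstLayer a.right B ◁ (leftUnitAdj B).counit ▷ firstLayer a.left B ⊗≫
      (firstLayerAdj a.adj B).counit)
    (𝟙 ((secondLayer A b.right ≫ rightUnit A) ≫ rightUnitorInv A ≫ secondLayer A b.left) ⊗≫
      secondLayer A b.right ◁ (rightUnitAdj A).counit ▷ secondLayer A b.left ⊗≫
      (secondLayerAdj A b.adj).counit) (crossLeftIso a b) ?_ ?_ ?_) ?_)
  · bicategory
  · exact (overlapGlue_eq a b).trans (by bicategory)
  · have h := cross_glue unitIso (leftUnitNat b.right) (rightUnitNat a.right) (rightUnitNat a.left)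
      (interchange a.right b.right) (interchange a.left b.right) (leftUnitAdj B) a.glue
      (firstLayerAdj a.adj B).counit (firstLayerAdj a.adj unit).counit
      (rightUnitNat_inv_glue a.adj) (interchange_inv_glue a.adj b.right)
    rw [crossRightInv_eq]
    simp only [crossMiddle]
    refine Eq.trans ?_ h
    bicategory
  · have h := cross_slide unitIso (leftUnitNat b.right) (leftUnitNat b.left) (rightUnitNat a.left)
      (interchange a.left b.right) (interchange a.left b.left) (leftUnitAdj B) (leftUnitAdj unit)
      (rightUnitAdj A).counit b.glue (secondLayerAdj A b.adj).counit
      (secondLayerAdj unit b.adj).counit (leftUnitorAdj_unit_unitary unit).2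
      (leftUnitorAdj_counit_unitary B).2 (leftUnitNat_inv_glue b.adj)
      (interchange_hom_glue b.adj a.left) (unitU' := dag (leftUnitAdj unit).unit)
      (counitB' := dag (leftUnitAdj B).counit)
    simp only [crossMiddle]
    refine Eq.trans ?_ (h.trans ?_)
    · bicategory
    · change _ = 𝟙 _ ⊗≫ b.right ◁ crossLeft a b ⊗≫ _
      rw [crossLeft]
      bicategory
  · bicategory

/-- With the coherences explicit, `d.left` and `d.right` can afterwards be unfolded for the overlap.
-/
theorem commPartialTranspose_eq_comp {D : C} (d : Boundary D) (l : a.strip ≫ b.strip ⟶ d.strip) :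
    commPartialTranspose a b d l = (λ_ _).inv ≫ a.cup ▷ (b.strip ≫ d.left) ≫
      (α_ a.strip a.strip (b.strip ≫ d.left)).hom ≫ a.strip ◁ (α_ a.strip b.strip d.left).inv ≫
      a.strip ◁ l ▷ d.left ≫ a.strip ◁ (α_ d.left d.right d.left).hom ≫
      (α_ a.strip d.left (d.right ≫ d.left)).inv ≫ (a.strip ≫ d.left) ◁ d.glue ≫ (ρ_ _).hom := by
  rw [commPartialTranspose]
  bicategory

/-- A composite of rotated copies of `δ` and of crossings of the left boundaries. -/
def rotatedComp (δ : a.strip ⟶ b.strip) : b.strip ≫ b.left ≫ leftUnitInv B ≫ firstLayer a.left B ⟶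
    a.strip ≫ b.left ≫ leftUnitInv B ≫ firstLayer a.left B :=
  𝟙 _ ⊗≫ b.strip ◁ (crossLeftIso a b).hom ⊗≫
    b.left ◁ partialTranspose b a (dag δ) ▷ (rightUnitorInv A ≫ secondLayer A b.left) ⊗≫
    halfTurnClockwise a b δ ▷ (a.left ≫ rightUnitorInv A ≫ secondLayer A b.left) ⊗≫
    a.strip ◁ (crossLeftIso a b).inv ⊗≫
    a.left ◁ partialTranspose a b δ ▷ (leftUnitInv B ≫ firstLayer a.left B) ⊗≫
    𝟙 (a.strip ≫ b.left ≫ leftUnitInv B ≫ firstLayer a.left B)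

theorem isUnitary_rotatedComp {δ : a.strip ⟶ b.strip} (hδ : IsComplementaryStructure a b δ)
    (hrot : IsRotatable a b δ) : IsUnitary (rotatedComp a b δ) := by
  unfold rotatedComp
  exact (IsUnitary.id _).bicategoricalComp (.bicategoricalComp
    (.whiskerLeft _ (isUnitary_crossLeft a b).dag) (.bicategoricalComp
    (.whiskerLeft _ (.whiskerRight (hrot.isUnitary_partialTranspose_dag hδ.2) _))
    (.bicategoricalComp (.whiskerRight (hrot.isUnitary_halfTurnClockwise hδ.1) _)
    (.bicategoricalComp (.whiskerLeft _ (isUnitary_crossLeft a b))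
    (.bicategoricalComp (.whiskerLeft _ (.whiskerRight hδ.2 _)) (.id _))))))

theorem commPartialTranspose_overlap (δ : a.strip ⟶ b.strip) :
    commPartialTranspose a b (a.overlap b) (commOfComp a b δ) = rotatedComp a b δ := by
  refine Eq.trans ?_ (commPartialTranspose_eq a b δ (crossMiddle a b) (overlapGlue a b)
    (crossLeftIso a b) (by refine Eq.trans ?_ ((crossMiddle_glue a b).trans ?_) <;> bicategory))
  rw [commPartialTranspose_eq_comp]
  have h : commOfComp a b δ = 𝟙 (a.strip ≫ b.strip) ⊗≫ a.left ◁ partialTranspose a b δ ▷ b.right ⊗≫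
    δ ▷ b.strip ≫ b.strip ◁ dag δ ⊗≫ b.left ◁ crossMiddle a b ▷ a.right ⊗≫
    𝟙 ((b.left ≫ leftUnitInv B ≫ firstLayer a.left B) ≫
      (secondLayer A b.right ≫ rightUnit A ≫ a.right)) := rfl
  -- λ is kept opaque while the boundaries of the overlap are unfolded; afterwards the two sides
  -- differ only by coherence.
  generalize commOfComp a b δ = l at h ⊢
  change (λ_ _).inv ≫ a.cup ▷ (b.strip ≫ b.left ≫ leftUnitInv B ≫ firstLayer a.left B) ≫
      (α_ a.strip a.strip (b.strip ≫ b.left ≫ leftUnitInv B ≫ firstLayer a.left B)).hom ≫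
      a.strip ◁ (α_ a.strip b.strip (b.left ≫ leftUnitInv B ≫ firstLayer a.left B)).inv ≫
      a.strip ◁ (l : _ ⟶ (b.left ≫ leftUnitInv B ≫ firstLayer a.left B) ≫
        (secondLayer A b.right ≫ rightUnit A ≫ a.right)) ▷
        (b.left ≫ leftUnitInv B ≫ firstLayer a.left B) ≫
      a.strip ◁ (α_ (b.left ≫ leftUnitInv B ≫ firstLayer a.left B)
        (secondLayer A b.right ≫ rightUnit A ≫ a.right)
        (b.left ≫ leftUnitInv B ≫ firstLayer a.left B)).hom ≫
      (α_ a.strip (b.left ≫ leftUnitInv B ≫ firstLayer a.left B)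
        ((secondLayer A b.right ≫ rightUnit A ≫ a.right) ≫
          b.left ≫ leftUnitInv B ≫ firstLayer a.left B)).inv ≫
      (a.strip ≫ b.left ≫ leftUnitInv B ≫ firstLayer a.left B) ◁ overlapGlue a b ≫
      (ρ_ (a.strip ≫ b.left ≫ leftUnitInv B ≫ firstLayer a.left B)).hom = _
  rw [h]
  bicategory

theorem isUnitary_commOfComp {δ : a.strip ⟶ b.strip} (h : IsComplementaryStructure a b δ) :
    IsUnitary (commOfComp a b δ) := by
  unfold commOfComp
  exact (IsUnitary.id _).bicategoricalComp (.bicategoricalComp (.whiskerLeft _ (.whiskerRight h.2 _))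
    (.comp (.whiskerRight h.1 _) (.bicategoricalComp (.whiskerLeft _ h.1.dag)
    (.bicategoricalComp (.whiskerLeft _ (.whiskerRight (isUnitary_crossMiddle a b) _)) (.id _)))))

end Overlap

/-- Let `C` be a dagger bicategory with a tensor product, and let `A` and `B` be regions of `C` with
boundaries satisfying the topological axioms. If `δ` is a complementary structure, then the
2-morphism built from three copies of `δ` is a communication structure. -/
theorem mainTheorem1 {C : Type u} [Bicategory.{w, v} C] [DaggerBicategory C] [TensorBicategory C]
    {A B : C} (a : Boundary A) (b : Boundary B) (δ : a.strip ⟶ b.strip)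
    (hδ : IsComplementaryStructure a b δ) (hrot : IsRotatable a b δ) :
    IsCommunicationStructure a b (a.overlap b) (commOfComp a b δ) := by
  refine ⟨isUnitary_commOfComp a b hδ, ?_⟩
  rw [commPartialTranspose_overlap]
  exact isUnitary_rotatedComp a b hδ hrot
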